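/- For $n\ge 1$ let $T$ be a uniformly random rooted labeled tree on $n$ vertices, i.e. a pair consisting of a tree with vertex set $\{1,\dots,n\}$ and a distinguished vertex (the root), and let its total height $H_n$ be the sum, over all vertices, of the distance to the root. For $n\ge 3$ let $$\alpha_k(n)=\frac{\mathbb E\big[(H_n-\mathbb E H_n)^k\big]}{\big(\mathbb E\big[(H_n-\mathbb E H_n)^2\big]\big)^{k/2}}$$ be the $k$-th standardized moment of $H_n$. Then for $3\le k\le 9$ the limit $\alpha_k=\lim_{n\to\infty}\alpha_k(n)$ exists, and $$\alpha_3=\frac{\left(6\pi-\frac{75}{4}\right)\sqrt3\,\sqrt{\frac{\pi}{10-3\pi}}}{10-3\pi}=0.7005665293\ldots,$$ $$\alpha_4=\frac{-189\pi^2+315\pi+884}{7(10-3\pi)^2}=3.560394897\ldots,$$ $$\alpha_5=\frac{\left(36\pi^2+\frac{75}{2}\pi-\frac{105845}{224}\right)\sqrt3\,\sqrt{\frac{\pi}{10-3\pi}}}{(10-3\pi)^2}=7.256375358\ldots,$$ $$\alpha_6=\frac{15}{16016}\cdot\frac{-144144\pi^3-720720\pi^2+3013725\pi+2120320}{(10-3\pi)^3}=27.68552569\ldots,$$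 $$\alpha_7=\frac{\left(162\pi^3+\frac{6615}{4}\pi^2-\frac{103965}{32}\pi-\frac{101897475}{9152}\right)\sqrt3\,\sqrt{\frac{\pi}{10-3\pi}}}{(10-3\pi)^3}=90.01718290\ldots,$$ $$\alpha_8=\frac{3}{2586584}\cdot\frac{-488864376\pi^4-8147739600\pi^3-455885430\pi^2+86568885375\pi+32820007040}{(10-3\pi)^4}=358.8090415\ldots,$$ $$\alpha_9=\frac{\left(648\pi^4+15795\pi^3+\frac{591867}{16}\pi^2-\frac{461286225}{2288}\pi-\frac{188411947088175}{662165504}\right)\sqrt3\,\sqrt{\frac{\pi}{10-3\pi}}}{(10-3\pi)^4}=1460.701134\ldots.$$ Here $=d\ldots$ means that $d$ is the decimal expansion truncated after the digits shown. -/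

import Mathlib

namespace RootedTreeHeights

open Classical in
/-- The rooted labeled trees on `n` vertices: pairs consisting of a tree on the vertex set `Fin n`
and a distinguished vertex, the root. -/
noncomputable def rootedTrees (n : ℕ) : Finset (SimpleGraph (Fin n) × Fin n) :=
  Finset.univ.filter fun T => T.1.IsTree

/-- The total height of a rooted tree: the sum, over all vertices, of the distance to the root. -/
noncomputable def totalHeight {n : ℕ} (T : SimpleGraph (Fin n) × Fin n) : ℕ :=
  ∑ v : Fin n, T.1.dist T.2 v

/-- The expected value of `f T`, for `T` uniformly distributed on the rooted labeled trees
on `n` vertices. -/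
noncomputable def expectation (n : ℕ) (f : SimpleGraph (Fin n) × Fin n → ℝ) : ℝ :=
  (∑ T ∈ rootedTrees n, f T) / ((rootedTrees n).card : ℝ)

/-- The average total height. -/
noncomputable def meanHeight (n : ℕ) : ℝ :=
  expectation n fun T => (totalHeight T : ℝ)

/-- The `k`-th moment about the mean of the total height. -/
noncomputable def centralMoment (n k : ℕ) : ℝ :=
  expectation n fun T => ((totalHeight T : ℝ) - meanHeight n) ^ k

/-- The `k`-th standardized moment of the total height: the `k`-th moment about the mean divided
by the `k`-th power of the standard deviation. -/
noncomputable def standardizedMoment (n k : ℕ) : ℝ :=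
  centralMoment n k / Real.sqrt (centralMoment n 2) ^ k

end RootedTreeHeights

/-! Mark a nonroot vertex `v` of a rooted tree and cut the first edge on the path from the root to
`v`. This is a bijection onto pairs of rooted trees on complementary vertex sets, with `v` marked in
the detached one. If that piece has `j` vertices and the pieces have total heights `h` and `h'`, the
whole has total height `j + h + h'`, and the detached piece loses one from each depth. Counting
marked vertices gives `card_mul_treeSum`. Weighting them by depth, whose sum is the total height,
gives `treeSum_mul`.

Let `T` be the exponential generating function of rooted trees, `y = 1 / (1 - T)` and `θ = X d/dX`.
The first identity says `θ T = y - 1`, hence `θ y = y ^ 3 - y ^ 2`. The second expresses the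
generating function of the sums of `h ^ (m + 1)` through those of lower powers and their images
under `θ`. So it is a polynomial in `y` of degree at most `3 m + 2`, whose coefficient in that
degree obeys the quadratic recursion `leadCoeff` (`hasLead_momentSeries`).

Abel's identity and the first recursion yield Cayley's formula, so `y` has coefficients `n ^ n /
n!`, which Stirling's formula estimates. Those of `y ^ 2` follow by comparison with central binomial
coefficients, those of higher powers from the formula for `θ y`. Only the top power of `y` matters
in the limit, so the `k`-th moment divided by `n ^ (3 k / 2)` converges to an explicit number
(`tendsto_moment`). Expanding about the mean gives the central moments, with limiting variance `(10
- 3 π) / 6 > 0`, and dividing by powers of its root gives the limits. The decimals follow from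
rational bounds for `π`. -/

namespace RootedTreeHeights

open Finset

/-! ### Rooted trees as parent functions -/

variable {V W : Type*}

/-- `f` is the parent function of a tree with vertex set `S` and root `r`, the root being its own
parent, extended by the identity outside `S`. -/
structure IsParent (S : Finset V) (f : V → V) (r : V) : Prop where
  root_mem : r ∈ S
  root : f r = r
  reach : ∀ v ∈ S, ∃ k, f^[k] v = r
  supp : ∀ v, v ∉ S → f v = v

/-- The number of steps from `v` to `r` along `f`. -/
noncomputable def depth (f : V → V) (r v : V) : ℕ := sInf {k | f^[k] v = r}

/-- The sum of the depths of the elements of `S`. -/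
noncomputable def totalDepth (S : Finset V) (f : V → V) (r : V) : ℕ := ∑ v ∈ S, depth f r v

@[simp] lemma depth_self (f : V → V) (r : V) : depth f r r = 0 :=
  Nat.sInf_eq_zero.2 (Or.inl rfl)

namespace IsParent

variable {S S' : Finset V} {f f₁ f₂ : V → V} {r c v : V}

lemma map_mem (h : IsParent S f r) (hv : v ∈ S) : f v ∈ S := by
  by_contra hn
  have hfix := h.supp _ hn
  obtain ⟨k, hk⟩ := h.reach v hv
  cases k with
  | zero =>
    have : v = r := hk
    subst this
    exact hn (h.root.symm ▸ hv)
  | succ k =>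
    rw [Function.iterate_succ_apply, Function.iterate_fixed hfix] at hk
    exact hn (hk ▸ h.root_mem)

lemma depth_eq (h : IsParent S f r) (hv : v ∈ S) (hr : v ≠ r) :
    depth f r v = depth f r (f v) + 1 := by
  have h1 : f^[depth f r v] v = r := Nat.sInf_mem (h.reach v hv)
  have h2 : f^[depth f r (f v)] (f v) = r := Nat.sInf_mem (h.reach _ (h.map_mem hv))
  apply le_antisymm
  · exact Nat.sInf_le (by simpa using h2)
  · cases hm : depth f r v with
    | zero => rw [hm] at h1; exact absurd h1 hr
    | succ m =>
      rw [hm, Function.iterate_succ_apply] at h1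
      exact Nat.succ_le_succ (Nat.sInf_le h1)

/-- A parent has depth one less, so this is induction on depth; it replaces explicit work with
iterates below. -/
lemma induction (h : IsParent S f r) {P : V → Prop} (h0 : P r)
    (h1 : ∀ v ∈ S, v ≠ r → P (f v) → P v) : ∀ v ∈ S, P v := by
  suffices ∀ n, ∀ v ∈ S, depth f r v = n → P v from fun v hv => this _ v hv rfl
  intro n
  induction n with
  | zero =>
    intro v hv hd
    by_cases hr : v = r
    · exact hr ▸ h0
    · rw [h.depth_eq hv hr] at hd; omega
  | succ n ih =>
    intro v hv hd
    by_cases hr : v = r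
    · exact hr ▸ h0
    · rw [h.depth_eq hv hr] at hd
      exact h1 v hv hr (ih _ (h.map_mem hv) (by omega))

/-- A nonroot vertex lies below a child of the root. -/
lemma exists_child (h : IsParent S f r) :
    ∀ v ∈ S, v ≠ r → ∃ c ∈ S, c ≠ r ∧ f c = r ∧ ∃ k, f^[k] v = c := by
  refine h.induction (fun h => absurd rfl h) fun v hv hr ih _ => ?_
  by_cases hf : f v = r
  · exact ⟨v, hv, hr, hf, 0, rfl⟩
  · obtain ⟨c, hc, hcr, hfc, k, hk⟩ := ih hf
    exact ⟨c, hc, hcr, hfc, k + 1, hk⟩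

end IsParent

/-- Once the orbit of `v` has passed through one child of `r` it stays at `r`, so it cannot meet a
second child. -/
lemma child_unique {f : V → V} {r c c' v : V} (hr : f r = r) (hc : f c = r) (hc' : f c' = r)
    (hcr : c ≠ r) (hcr' : c' ≠ r) (h : ∃ k, f^[k] v = c) (h' : ∃ k, f^[k] v = c') : c = c' := by
  obtain ⟨k, hk⟩ := h
  obtain ⟨k', hk'⟩ := h'
  wlog hle : k ≤ k' generalizing c c' k k'
  · exact (this hc' hc hcr' hcr k' hk' k hk (by omega)).symm
  obtain ⟨m, rfl⟩ := Nat.exists_eq_add_of_le' hle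
  rw [Function.iterate_add_apply, hk] at hk'
  cases m with
  | zero => exact hk'
  | succ m =>
    rw [Function.iterate_succ_apply, hc, Function.iterate_fixed hr] at hk'
    exact absurd hk'.symm hcr'

/-! ### Cutting and gluing at a child of the root -/

section Glue

variable [DecidableEq V]

/-- Attach the tree `(f₁, c)` on `S'` to the vertex `r` of the tree with parent function `f₂`. -/
def glue (S' : Finset V) (f₁ : V → V) (c : V) (f₂ : V → V) (r : V) : V → V := fun x =>
  if x ∈ S' then (if x = c then r else f₁ x) else f₂ x

variable {S S' : Finset V} {f f₁ f₂ : V → V} {r c v : V}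

lemma glue_child (hc : c ∈ S') : glue S' f₁ c f₂ r c = r := by simp [glue, hc]

lemma glue_of_mem (hv : v ∈ S') (hvc : v ≠ c) : glue S' f₁ c f₂ r v = f₁ v := by
  simp [glue, hv, hvc]

lemma glue_of_notMem (hv : v ∉ S') : glue S' f₁ c f₂ r v = f₂ v := by simp [glue, hv]

namespace IsParent

lemma glue (h₁ : IsParent S' f₁ c) (h₂ : IsParent (S \ S') f₂ r) (hS : S' ⊆ S) :
    IsParent S (glue S' f₁ c f₂ r) r := by
  have hr := mem_sdiff.1 h₂.root_mem
  have hout : ∀ v ∈ S \ S', ∃ k, (RootedTreeHeights.glue S' f₁ c f₂ r)^[k] v = r := by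
    refine h₂.induction ⟨0, rfl⟩ fun v hv hvr ⟨k, hk⟩ => ⟨k + 1, ?_⟩
    rwa [Function.iterate_succ_apply, glue_of_notMem (mem_sdiff.1 hv).2]
  have hin : ∀ v ∈ S', ∃ k, (RootedTreeHeights.glue S' f₁ c f₂ r)^[k] v = r := by
    refine h₁.induction ⟨1, glue_child h₁.root_mem⟩ fun v hv hvr ⟨k, hk⟩ => ⟨k + 1, ?_⟩
    rwa [Function.iterate_succ_apply, glue_of_mem hv hvr]
  refine ⟨hr.1, ?_, fun v hv => ?_, fun v hv => ?_⟩
  · rw [glue_of_notMem hr.2, h₂.root]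
  · by_cases hv' : v ∈ S'
    · exact hin v hv'
    · exact hout v (mem_sdiff.2 ⟨hv, hv'⟩)
  · rw [glue_of_notMem fun h => hv (hS h)]
    exact h₂.supp v fun h => hv (mem_sdiff.1 h).1

lemma depth_glue_of_mem_sdiff (h₁ : IsParent S' f₁ c) (h₂ : IsParent (S \ S') f₂ r)
    (hS : S' ⊆ S) :
    ∀ v ∈ S \ S', depth (RootedTreeHeights.glue S' f₁ c f₂ r) r v = depth f₂ r v := by
  refine h₂.induction (by simp) fun v hv hvr ih => ?_
  rw [(h₁.glue h₂ hS).depth_eq (mem_sdiff.1 hv).1 hvr, h₂.depth_eq hv hvr,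
    glue_of_notMem (mem_sdiff.1 hv).2, ih]

lemma depth_glue_of_mem (h₁ : IsParent S' f₁ c) (h₂ : IsParent (S \ S') f₂ r) (hS : S' ⊆ S) :
    ∀ v ∈ S', depth (RootedTreeHeights.glue S' f₁ c f₂ r) r v = 1 + depth f₁ c v := by
  have hne : ∀ v ∈ S', v ≠ r := fun v hv hvr => (mem_sdiff.1 h₂.root_mem).2 (hvr ▸ hv)
  refine h₁.induction ?_ fun v hv hvc ih => ?_
  · rw [(h₁.glue h₂ hS).depth_eq (hS h₁.root_mem) (hne _ h₁.root_mem), glue_child h₁.root_mem]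
    simp
  · rw [(h₁.glue h₂ hS).depth_eq (hS hv) (hne v hv), h₁.depth_eq hv hvc, glue_of_mem hv hvc, ih,
      add_assoc]

lemma totalDepth_glue (h₁ : IsParent S' f₁ c) (h₂ : IsParent (S \ S') f₂ r) (hS : S' ⊆ S) :
    totalDepth S (RootedTreeHeights.glue S' f₁ c f₂ r) r
      = #S' + totalDepth S' f₁ c + totalDepth (S \ S') f₂ r := by
  rw [totalDepth, ← sum_sdiff hS, sum_congr rfl (h₁.depth_glue_of_mem_sdiff h₂ hS),
    sum_congr rfl (h₁.depth_glue_of_mem h₂ hS), sum_add_distrib, totalDepth, totalDepth]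
  simp
  ring

/-- Orbits starting in `S \ S'` never leave it, whereas those starting in `S'` reach `c`. Hence `S'`
can be recovered from the glued function and `c`. -/
lemma mem_iff_glue_iterate (h₁ : IsParent S' f₁ c) (h₂ : IsParent (S \ S') f₂ r) (hv : v ∈ S) :
    v ∈ S' ↔ ∃ k, (RootedTreeHeights.glue S' f₁ c f₂ r)^[k] v = c := by
  constructor
  · revert v
    suffices ∀ v ∈ S', ∃ k, (RootedTreeHeights.glue S' f₁ c f₂ r)^[k] v = c from
      fun v _ hv => this v hv
    refine h₁.induction ⟨0, rfl⟩ fun v hv hvc ⟨k, hk⟩ => ⟨k + 1, ?_⟩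
    rwa [Function.iterate_succ_apply, glue_of_mem hv hvc]
  · rintro ⟨k, hk⟩
    by_contra hv'
    have key : ∀ k, (RootedTreeHeights.glue S' f₁ c f₂ r)^[k] v ∈ S \ S' := by
      intro k
      induction k with
      | zero => exact mem_sdiff.2 ⟨hv, hv'⟩
      | succ k ih =>
        rw [Function.iterate_succ_apply', glue_of_notMem (mem_sdiff.1 ih).2]
        exact h₂.map_mem ih
    exact (mem_sdiff.1 (key k)).2 (by rw [hk]; exact h₁.root_mem)

/-- Gluing is injective, once a vertex of the attached tree is given. -/
lemma glue_injective {S₁ S₂ : Finset V} {g₁ g₂ : V → V} {c' : V}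
    (h₁ : IsParent S₁ f₁ c) (h₂ : IsParent (S \ S₁) f₂ r) (hS₁ : S₁ ⊆ S) (hv₁ : v ∈ S₁)
    (k₁ : IsParent S₂ g₁ c') (k₂ : IsParent (S \ S₂) g₂ r) (hS₂ : S₂ ⊆ S) (hv₂ : v ∈ S₂)
    (heq : RootedTreeHeights.glue S₁ f₁ c f₂ r = RootedTreeHeights.glue S₂ g₁ c' g₂ r) :
    S₁ = S₂ ∧ f₁ = g₁ ∧ c = c' ∧ f₂ = g₂ := by
  have hc : c = c' := by
    refine child_unique (h₁.glue h₂ hS₁).root (glue_child h₁.root_mem)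
      (heq ▸ glue_child k₁.root_mem) (fun h => (mem_sdiff.1 h₂.root_mem).2 (h ▸ h₁.root_mem))
      (fun h => (mem_sdiff.1 k₂.root_mem).2 (h ▸ k₁.root_mem))
      ((h₁.mem_iff_glue_iterate h₂ (hS₁ hv₁)).1 hv₁)
      (heq ▸ (k₁.mem_iff_glue_iterate k₂ (hS₂ hv₂)).1 hv₂)
  subst hc
  have hS : S₁ = S₂ := by
    ext x
    by_cases hx : x ∈ S
    · rw [h₁.mem_iff_glue_iterate h₂ hx, k₁.mem_iff_glue_iterate k₂ hx, heq]
    · exact ⟨fun h => absurd (hS₁ h) hx, fun h => absurd (hS₂ h) hx⟩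
  subst hS
  refine ⟨rfl, funext fun x => ?_, rfl, funext fun x => ?_⟩
  · by_cases hx : x ∈ S₁
    · by_cases hxc : x = c
      · rw [hxc, h₁.root, k₁.root]
      · have := congrFun heq x
        rwa [glue_of_mem hx hxc, glue_of_mem hx hxc] at this
    · rw [h₁.supp x hx, k₁.supp x hx]
  · by_cases hx : x ∈ S₁
    · rw [h₂.supp x (fun h => (mem_sdiff.1 h).2 hx), k₂.supp x (fun h => (mem_sdiff.1 h).2 hx)]
    · have := congrFun heq x
      rwa [glue_of_notMem hx, glue_of_notMem hx] at this

/-- Every tree arises by gluing the tree of descendants of a child of the root. -/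
lemma exists_glue (h : IsParent S f r) (hv : v ∈ S) (hvr : v ≠ r) :
    ∃ S' ⊆ S, ∃ f₁ c f₂, IsParent S' f₁ c ∧ IsParent (S \ S') f₂ r ∧ v ∈ S' ∧
      RootedTreeHeights.glue S' f₁ c f₂ r = f := by
  classical
  obtain ⟨c, hcS, hcr, hfc, hvc⟩ := h.exists_child v hv hvr
  set S' : Finset V := S.filter fun x => ∃ k, f^[k] x = c with hS'
  have hmem : ∀ x, x ∈ S' ↔ x ∈ S ∧ ∃ k, f^[k] x = c := fun x => by simp [hS']
  have hstep : ∀ x ∈ S, f x ∈ S' → x ∈ S' := fun x hx hfx => by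
    obtain ⟨k, hk⟩ := ((hmem _).1 hfx).2
    exact (hmem _).2 ⟨hx, k + 1, hk⟩
  have hrS' : r ∉ S' := fun hr => by
    obtain ⟨k, hk⟩ := ((hmem _).1 hr).2
    rw [Function.iterate_fixed h.root] at hk
    exact hcr hk.symm
  have hcS' : c ∈ S' := (hmem _).2 ⟨hcS, 0, rfl⟩
  have hS'S : S' ⊆ S := filter_subset _ _
  -- The two pieces are the restrictions of `f` to the descendants of `c` and to the rest, with `c`
  -- made a root and each function set to the identity off its piece.
  refine ⟨S', hS'S, fun x => if x ∈ S' then (if x = c then c else f x) else x, c,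
    fun x => if x ∈ S \ S' then f x else x, ⟨hcS', by simp, ?_, ?_⟩,
    ⟨mem_sdiff.2 ⟨h.root_mem, hrS'⟩, by simp [h.root], ?_, ?_⟩, (hmem _).2 ⟨hv, hvc⟩, ?_⟩
  · intro x hx
    obtain ⟨hxS, k, hk⟩ := (hmem _).1 hx
    clear hx
    induction k generalizing x with
    | zero => exact ⟨0, hk⟩
    | succ k ih =>
      by_cases hxc : x = c
      · exact ⟨0, hxc⟩
      · obtain ⟨m, hm⟩ := ih (f x) (h.map_mem hxS) hk
        refine ⟨m + 1, ?_⟩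
        rw [Function.iterate_succ_apply, if_pos ((hmem _).2 ⟨hxS, k + 1, hk⟩), if_neg hxc, hm]
  · intro x hx
    simp [hx]
  · suffices ∀ x ∈ S, x ∉ S' → ∃ k, (fun x => if x ∈ S \ S' then f x else x)^[k] x = r from
      fun x hx => this x (mem_sdiff.1 hx).1 (mem_sdiff.1 hx).2
    refine h.induction (fun _ => ⟨0, rfl⟩) fun x hx _ ih hx' => ?_
    obtain ⟨k, hk⟩ := ih fun hf => hx' (hstep x hx hf)
    refine ⟨k + 1, ?_⟩
    rw [Function.iterate_succ_apply, if_pos (mem_sdiff.2 ⟨hx, hx'⟩), hk]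
  · intro x hx
    simp only [hx, if_false]
  · funext x
    by_cases hx : x ∈ S'
    · by_cases hxc : x = c
      · rw [hxc, glue_child hcS', hfc]
      · rw [glue_of_mem hx hxc, if_pos hx, if_neg hxc]
    · rw [glue_of_notMem hx]
      by_cases hxS : x ∈ S
      · rw [if_pos (mem_sdiff.2 ⟨hxS, hx⟩)]
      · rw [if_neg fun h => hxS (mem_sdiff.1 h).1, h.supp x hxS]

end IsParent

end Glue

/-! ### Recursions for sums over trees -/

open Classical in
/-- The trees with vertex set `S`, as pairs of a parent function and a root. -/
noncomputable def parentTrees [Fintype V] (S : Finset V) : Finset ((V → V) × V) :=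
  univ.filter fun p => IsParent S p.1 p.2

@[simp] lemma mem_parentTrees [Fintype V] {S : Finset V} {p : (V → V) × V} :
    p ∈ parentTrees S ↔ IsParent S p.1 p.2 := by
  simp [parentTrees]

/-- Cutting the edge that joins the root to the subtree containing a given vertex. -/
lemma sum_parentTrees_cut [Fintype V] [DecidableEq V] (S : Finset V) (φ : ℕ → ℕ → ℝ) :
    ∑ p ∈ parentTrees S, ∑ v ∈ S.erase p.2, φ (depth p.1 p.2 v) (totalDepth S p.1 p.2)
      = ∑ S' ∈ S.powerset, ∑ p ∈ parentTrees S', ∑ q ∈ parentTrees (S \ S'), ∑ v ∈ S',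
          φ (1 + depth p.1 p.2 v)
            (#S' + totalDepth S' p.1 p.2 + totalDepth (S \ S') q.1 q.2) := by
  simp only [sum_sigma']
  symm
  refine sum_bij (fun x _ => ⟨(glue x.1 x.2.1.1 x.2.1.2 x.2.2.1.1 x.2.2.1.2, x.2.2.1.2),
    x.2.2.2⟩) ?_ ?_ ?_ ?_
  · rintro ⟨S', ⟨f₁, c⟩, ⟨f₂, r⟩, v⟩ hx
    simp only [mem_sigma, mem_powerset, mem_parentTrees, mem_erase] at hx ⊢
    obtain ⟨hS, h₁, h₂, hv⟩ := hx
    exact ⟨h₁.glue h₂ hS, fun h => (mem_sdiff.1 h₂.root_mem).2 (h ▸ hv), hS hv⟩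
  · rintro ⟨S₁, ⟨f₁, c⟩, ⟨f₂, r⟩, v⟩ hx ⟨S₂, ⟨g₁, c'⟩, ⟨g₂, r'⟩, v'⟩ hy heq
    simp only [mem_sigma, mem_powerset, mem_parentTrees] at hx hy
    simp only [Sigma.mk.injEq, Prod.mk.injEq, heq_eq_eq] at heq
    obtain ⟨⟨heq, rfl⟩, rfl⟩ := heq
    obtain ⟨rfl, rfl, rfl, rfl⟩ := hx.2.1.glue_injective hx.2.2.1 hx.1 hx.2.2.2 hy.2.1 hy.2.2.1
      hy.1 hy.2.2.2 heq
    rfl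
  · rintro ⟨⟨f, r⟩, v⟩ hx
    simp only [mem_sigma, mem_parentTrees, mem_erase] at hx
    obtain ⟨S', hS, f₁, c, f₂, h₁, h₂, hv, hg⟩ := hx.1.exists_glue hx.2.2 hx.2.1
    refine ⟨⟨S', ⟨f₁, c⟩, ⟨f₂, r⟩, v⟩, ?_, ?_⟩
    · simp only [mem_sigma, mem_powerset, mem_parentTrees]
      exact ⟨hS, h₁, h₂, hv⟩
    · simp only [hg]
  · rintro ⟨S', ⟨f₁, c⟩, ⟨f₂, r⟩, v⟩ hx
    simp only [mem_sigma, mem_powerset, mem_parentTrees] at hx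
    obtain ⟨hS, h₁, h₂, hv⟩ := hx
    simp only [h₁.depth_glue_of_mem h₂ hS v hv, h₁.totalDepth_glue h₂ hS]

/-- Sums over the trees on `S` depend only on the cardinality of `S`. -/
lemma sum_parentTrees_image [Fintype V] [Fintype W] (S : Finset V) (j : W → V)
    (hj : Function.Injective j) (hS : ∀ v, v ∈ S ↔ v ∈ Set.range j) (ψ : ℕ → ℝ) :
    ∑ p ∈ parentTrees S, ψ (totalDepth S p.1 p.2)
      = ∑ p ∈ parentTrees (univ : Finset W), ψ (totalDepth univ p.1 p.2) := by
  classical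
  have hmem : ∀ w, j w ∈ S := fun w => (hS _).2 ⟨w, rfl⟩
  -- Conjugating `f` by `j` on the range of `j`, with the identity elsewhere, transports trees on
  -- `W` to trees on `S`.
  have happ : ∀ (f : W → W) w, Function.extend j (j ∘ f) id (j w) = j (f w) := fun f w =>
    hj.extend_apply _ _ _
  have hit : ∀ (f : W → W) k w, (Function.extend j (j ∘ f) id)^[k] (j w) = j (f^[k] w) := by
    intro f k w
    induction k with
    | zero => rfl
    | succ k ih => rw [Function.iterate_succ_apply', ih, happ, Function.iterate_succ_apply']
  have hdepth : ∀ (f : W → W) r w,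
      depth (Function.extend j (j ∘ f) id) (j r) (j w) = depth f r w := fun f r w => by
    simp only [depth, hit, hj.eq_iff]
  have hSmap : S = univ.map ⟨j, hj⟩ := by ext v; simp [hS]
  have htot : ∀ (f : W → W) r,
      totalDepth S (Function.extend j (j ∘ f) id) (j r) = totalDepth univ f r := fun f r => by
    simp only [totalDepth, hSmap, sum_map, Function.Embedding.coeFn_mk, hdepth]
  symm
  refine sum_bij (fun p _ => (Function.extend j (j ∘ p.1) id, j p.2)) ?_ ?_ ?_ ?_
  · rintro ⟨f, r⟩ hp
    rw [mem_parentTrees] at hp ⊢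
    replace hp : IsParent univ f r := hp
    refine ⟨hmem _, (happ f r).trans (congrArg j hp.root), fun v hv => ?_, fun v hv => ?_⟩
    · obtain ⟨w, rfl⟩ := (hS v).1 hv
      obtain ⟨k, hk⟩ := hp.reach w (mem_univ _)
      exact ⟨k, by rw [hit, hk]⟩
    · exact Function.extend_apply' _ _ _ fun h => hv ((hS v).2 h)
  · rintro ⟨f, r⟩ _ ⟨f', r'⟩ _ heq
    simp only [Prod.mk.injEq] at heq
    refine Prod.ext (funext fun w => hj ?_) (hj heq.2)
    rw [← happ, heq.1, happ]
  · rintro ⟨g, r⟩ hp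
    rw [mem_parentTrees] at hp
    replace hp : IsParent S g r := hp
    obtain ⟨r, rfl⟩ := (hS r).1 hp.root_mem
    choose f hf using fun w => (hS _).1 (hp.map_mem (hmem w))
    have hg : Function.extend j (j ∘ f) id = g := by
      funext v
      by_cases hv : v ∈ S
      · obtain ⟨w, rfl⟩ := (hS v).1 hv
        rw [happ, hf]
      · rw [Function.extend_apply' _ _ _ fun h => hv ((hS v).2 h), hp.supp v hv]
        rfl
    subst hg
    refine ⟨(f, r), ?_, rfl⟩
    rw [mem_parentTrees]
    refine ⟨mem_univ _, hj ((hf r).trans hp.root), fun w _ => ?_,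
      fun w hw => absurd (mem_univ w) hw⟩
    obtain ⟨k, hk⟩ := hp.reach _ (hmem w)
    exact ⟨k, hj (by rw [← hit, hk])⟩
  · rintro ⟨f, r⟩ _
    rw [htot]

/-- The sum of `ψ` of the total height over all rooted trees on `n` vertices. -/
noncomputable def treeSum (n : ℕ) (ψ : ℕ → ℝ) : ℝ :=
  ∑ p ∈ parentTrees (univ : Finset (Fin n)), ψ (totalDepth univ p.1 p.2)

lemma sum_parentTrees_eq_treeSum [Fintype V] (S : Finset V) (ψ : ℕ → ℝ) :
    ∑ p ∈ parentTrees S, ψ (totalDepth S p.1 p.2) = treeSum #S ψ := by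
  refine sum_parentTrees_image S (fun i => (S.equivFin.symm i : V))
    (Subtype.val_injective.comp S.equivFin.symm.injective) (fun v => ⟨fun hv => ?_, ?_⟩) ψ
  · exact ⟨S.equivFin ⟨v, hv⟩, by simp⟩
  · rintro ⟨i, rfl⟩
    exact (S.equivFin.symm i).2

lemma sum_powerset_parentTrees (n : ℕ) (φ : ℕ → ℕ → ℕ → ℝ) :
    ∑ S ∈ (univ : Finset (Fin n)).powerset, ∑ p ∈ parentTrees S, ∑ q ∈ parentTrees (univ \ S),
        φ #S (totalDepth S p.1 p.2) (totalDepth (univ \ S) q.1 q.2)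
      = ∑ j ∈ range (n + 1), (n.choose j : ℝ) *
          treeSum j fun h => treeSum (n - j) fun h' => φ j h h' := by
  have := sum_powerset_apply_card
    (x := (univ : Finset (Fin n)))
    (fun j => treeSum j fun h => treeSum (n - j) fun h' => φ j h h')
  rw [card_univ, Fintype.card_fin] at this
  simp only [nsmul_eq_mul] at this
  rw [← this]
  refine sum_congr rfl fun S hS => ?_
  rw [← sum_parentTrees_eq_treeSum S]
  refine sum_congr rfl fun p _ => ?_
  rw [sum_parentTrees_eq_treeSum (univ \ S) (fun h' => φ #S (totalDepth S p.1 p.2) h')]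
  congr 1
  rw [card_sdiff_of_subset (subset_univ _), card_univ, Fintype.card_fin]

/-- Each tree has `n - 1` nonroot vertices to mark; after the cut the mark ranges over the `j`
vertices of the detached piece. -/
lemma card_mul_treeSum (n : ℕ) (ψ : ℕ → ℝ) :
    n * treeSum n ψ = treeSum n ψ + ∑ j ∈ range (n + 1), (n.choose j : ℝ) *
      treeSum j fun h => treeSum (n - j) fun h' => j * ψ (j + h + h') := by
  have h := sum_parentTrees_cut (univ : Finset (Fin n)) (fun _ h => ψ h)
  rw [← sum_powerset_parentTrees n fun j h h' => j * ψ (j + h + h')]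
  simp only [sum_const, nsmul_eq_mul] at h
  rw [← h, treeSum, ← sum_add_distrib, mul_sum]
  refine sum_congr rfl fun p _ => ?_
  have : (#(univ.erase p.2) : ℝ) = n - 1 := by
    rw [cast_card_erase_of_mem (mem_univ _)]; simp
  rw [this]
  ring

/-- Here the mark is weighted by its depth. The weights add up to the total height before the cut,
and to `j + h` after it, since every depth in the detached piece was larger by one. -/
lemma treeSum_mul (n : ℕ) (ψ : ℕ → ℝ) :
    treeSum n (fun h => h * ψ h) = ∑ j ∈ range (n + 1), (n.choose j : ℝ) *
      treeSum j fun h => treeSum (n - j) fun h' => (j + h) * ψ (j + h + h') := by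
  have h := sum_parentTrees_cut (univ : Finset (Fin n)) (fun d h => d * ψ h)
  rw [← sum_powerset_parentTrees n fun j h h' => (j + h) * ψ (j + h + h')]
  simp only [← sum_mul] at h
  convert h using 1
  · refine sum_congr rfl fun p _ => ?_
    rw [← Nat.cast_sum, sum_erase _ (depth_self _ _), totalDepth]
  · refine sum_congr rfl fun S _ => sum_congr rfl fun p _ => sum_congr rfl fun q _ => ?_
    push_cast
    rw [sum_add_distrib, totalDepth]
    simp

end RootedTreeHeights

/-! ### Parent functions and graph-theoretic trees -/

namespace RootedTreeHeights

open Finset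

section Graph

variable {V : Type*}

/-- The graph that joins every vertex to its parent. -/
def parentGraph (f : V → V) : SimpleGraph V := SimpleGraph.fromRel fun u v => f u = v

lemma parentGraph_adj {f : V → V} {u v : V} :
    (parentGraph f).Adj u v ↔ u ≠ v ∧ (f u = v ∨ f v = u) := by
  simp [parentGraph]

namespace IsParent

variable [Fintype V] {f g : V → V} {r : V}

lemma apply_ne (h : IsParent univ f r) {v : V} (hv : v ≠ r) : f v ≠ v := fun hf => by
  have := h.depth_eq (mem_univ v) hv
  rw [hf] at this
  omega

lemma parentGraph_adj_apply (h : IsParent univ f r) {v : V} (hv : v ≠ r) :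
    (parentGraph f).Adj v (f v) :=
  parentGraph_adj.2 ⟨(h.apply_ne hv).symm, Or.inl rfl⟩

lemma parentGraph_connected (h : IsParent univ f r) : (parentGraph f).Connected := by
  have key : ∀ v, (parentGraph f).Reachable v r := fun v =>
    h.induction (P := fun v => (parentGraph f).Reachable v r) (SimpleGraph.Reachable.refl _)
      (fun v _ hvr ih => (h.parentGraph_adj_apply hvr).reachable.trans ih) v (mem_univ v)
  have : Nonempty V := ⟨r⟩
  exact ⟨fun u v => (key u).trans (key v).symm⟩

lemma depth_le_of_adj (h : IsParent univ f r) {u v : V} (huv : (parentGraph f).Adj u v) :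
    depth f r v ≤ depth f r u + 1 := by
  obtain ⟨hne, rfl | rfl⟩ := parentGraph_adj.1 huv
  · by_cases hu : u = r
    · rw [hu, h.root]; simp
    · rw [h.depth_eq (mem_univ u) hu]; omega
  · by_cases hv : v = r
    · rw [hv]; simp
    · rw [h.depth_eq (mem_univ v) hv]

lemma depth_le_length (h : IsParent univ f r) {u v : V} (p : (parentGraph f).Walk u v) :
    depth f r v ≤ depth f r u + p.length := by
  induction p with
  | nil => simp
  | cons huv p ih =>
    have := h.depth_le_of_adj huv
    rw [SimpleGraph.Walk.length_cons]
    omega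

lemma dist_eq_depth (h : IsParent univ f r) (v : V) :
    (parentGraph f).dist r v = depth f r v := by
  apply le_antisymm
  · refine h.induction (P := fun v => (parentGraph f).dist r v ≤ depth f r v) (by simp)
      (fun v hv hvr ih => ?_) v (mem_univ v)
    rw [h.depth_eq hv hvr]
    calc (parentGraph f).dist r v
        ≤ (parentGraph f).dist r (f v) + (parentGraph f).dist (f v) v :=
          h.parentGraph_connected.dist_triangle
      _ ≤ depth f r (f v) + 1 := by
          rw [SimpleGraph.dist_eq_one_iff_adj.2 (h.parentGraph_adj_apply hvr).symm]
          omega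
  · obtain ⟨p, hp⟩ := h.parentGraph_connected.exists_walk_length_eq_dist r v
    have := h.depth_le_length p
    rw [depth_self] at this
    omega

lemma parentGraph_isTree (h : IsParent univ f r) : (parentGraph f).IsTree := by
  classical
  rw [SimpleGraph.isTree_iff_connected_and_card]
  refine ⟨h.parentGraph_connected, le_antisymm ?_
    h.parentGraph_connected.card_vert_le_card_edgeSet_add_one⟩
  -- Every edge joins a nonroot vertex to its parent, which bounds the number of edges by the number
  -- of vertices minus one.
  have hsub : (parentGraph f).edgeSet ⊆ ((univ.erase r).image fun v => s(v, f v) : Finset _) := by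
    intro e he
    induction e with
    | h u v =>
      have huv : u ≠ v ∧ (f u = v ∨ f v = u) := parentGraph_adj.1 he
      rw [mem_coe, mem_image]
      obtain ⟨hne, rfl | rfl⟩ := huv
      · exact ⟨u, mem_erase.2 ⟨fun hu => hne (by rw [hu, h.root]), mem_univ _⟩, rfl⟩
      · exact ⟨v, mem_erase.2 ⟨fun hu => hne (by rw [hu, h.root]), mem_univ _⟩, Sym2.eq_swap⟩
  have h1 := Nat.card_mono (Finset.finite_toSet _) hsub
  rw [Nat.card_coe_set_eq, Nat.card_coe_set_eq, Set.ncard_coe_finset] at h1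
  have h2 := card_image_le (s := univ.erase r) (f := fun v => s(v, f v))
  rw [card_erase_of_mem (mem_univ r), card_univ] at h2
  have h3 : 0 < Fintype.card V := Fintype.card_pos_iff.2 ⟨r⟩
  rw [Nat.card_coe_set_eq, Nat.card_eq_fintype_card (α := V)]
  omega

/-- Depth is distance from the root, so the graph determines it. If `f v` and `g v` differed,
adjacency would force `f (g v) = v`, making `g v` deeper than `v`, although it is shallower as the
parent under `g`. -/
lemma parentGraph_injective (hf : IsParent univ f r) (hg : IsParent univ g r)
    (h : parentGraph f = parentGraph g) : f = g := by
  funext v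
  by_cases hv : v = r
  · rw [hv, hf.root, hg.root]
  · have hadj : (parentGraph f).Adj v (g v) := h ▸ hg.parentGraph_adj_apply hv
    rcases (parentGraph_adj.1 hadj).2 with h1 | h1
    · exact h1
    · have h2 := hg.depth_eq (mem_univ v) hv
      rw [← hg.dist_eq_depth, ← hg.dist_eq_depth, ← h, hf.dist_eq_depth, hf.dist_eq_depth] at h2
      by_cases hgr : g v = r
      · rw [hgr, hf.root] at h1
        exact absurd h1.symm hv
      · have h3 := hf.depth_eq (mem_univ (g v)) hgr
        rw [h1] at h3
        omega

end IsParent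

lemma exists_parentGraph_eq [Fintype V] {G : SimpleGraph V} (hG : G.IsTree) (r : V) :
    ∃ f, IsParent univ f r ∧ parentGraph f = G := by
  classical
  -- The parent is the next vertex on a shortest walk to the root. The resulting graph is a
  -- connected subgraph of `G`, so minimality of trees among connected graphs gives equality.
  have hex : ∀ v, ∃ u, (v = r → u = r) ∧ (v ≠ r → G.Adj v u ∧ G.dist u r < G.dist v r) := by
    intro v
    by_cases hv : v = r
    · exact ⟨r, fun _ => rfl, fun h => absurd hv h⟩
    · obtain ⟨p, hp⟩ := hG.1.exists_walk_length_eq_dist v r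
      cases p with
      | nil => exact absurd rfl hv
      | @cons _ u _ hadj q =>
        refine ⟨u, fun h => absurd h hv, fun _ => ⟨hadj, ?_⟩⟩
        rw [← hp, SimpleGraph.Walk.length_cons]
        exact Nat.lt_succ_of_le (SimpleGraph.dist_le q)
  choose f hf₀ hf₁ using hex
  have hP : IsParent univ f r := by
    refine ⟨mem_univ r, hf₀ r rfl, fun v _ => ?_, fun v hv => absurd (mem_univ v) hv⟩
    suffices ∀ n v, G.dist v r ≤ n → ∃ k, f^[k] v = r from this _ v le_rfl
    intro n
    induction n with
    | zero => exact fun v hv => ⟨0, hG.1.dist_eq_zero_iff.1 (Nat.le_zero.1 hv)⟩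
    | succ n ih =>
      intro v hv
      by_cases hvr : v = r
      · exact ⟨0, hvr⟩
      · obtain ⟨k, hk⟩ := ih (f v) (by have := (hf₁ v hvr).2; omega)
        exact ⟨k + 1, hk⟩
  refine ⟨f, hP, ?_⟩
  have hle : parentGraph f ≤ G := by
    intro u v huv
    obtain ⟨hne, rfl | rfl⟩ := parentGraph_adj.1 huv
    · exact (hf₁ u fun hu => hne (by rw [hu, hP.root])).1
    · exact (hf₁ v fun hu => hne (by rw [hu, hP.root])).1.symm
  exact le_antisymm hle
    ((SimpleGraph.isTree_iff_minimal_connected.1 hG).le_of_le hP.parentGraph_connected hle)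

end Graph

lemma mem_rootedTrees {n : ℕ} {T : SimpleGraph (Fin n) × Fin n} :
    T ∈ rootedTrees n ↔ T.1.IsTree := by
  simp [rootedTrees]

lemma sum_rootedTrees (n : ℕ) (ψ : ℕ → ℝ) :
    ∑ T ∈ rootedTrees n, ψ (totalHeight T) = treeSum n ψ := by
  symm
  refine sum_bij (fun p _ => (parentGraph p.1, p.2)) ?_ ?_ ?_ ?_
  · rintro ⟨f, r⟩ hp
    rw [mem_parentTrees] at hp
    exact mem_rootedTrees.2 hp.parentGraph_isTree
  · rintro ⟨f, r⟩ hp ⟨g, r'⟩ hq heq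
    rw [mem_parentTrees] at hp hq
    simp only [Prod.mk.injEq] at heq
    obtain ⟨heq, rfl⟩ := heq
    exact Prod.ext (hp.parentGraph_injective hq heq) rfl
  · rintro ⟨G, r⟩ hT
    obtain ⟨f, hf, hG⟩ := exists_parentGraph_eq (mem_rootedTrees.1 hT) r
    exact ⟨(f, r), mem_parentTrees.2 hf, Prod.ext hG rfl⟩
  · rintro ⟨f, r⟩ hp
    rw [mem_parentTrees] at hp
    simp only [totalDepth, totalHeight, hp.dist_eq_depth]

lemma expectation_totalHeight (n : ℕ) (ψ : ℕ → ℝ) :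
    expectation n (fun T => ψ (totalHeight T)) = treeSum n ψ / treeSum n fun _ => 1 := by
  rw [expectation, sum_rootedTrees n ψ, ← sum_rootedTrees n fun _ => 1]
  simp

end RootedTreeHeights

/-! ### Generating functions and their leading terms -/

namespace RootedTreeHeights

open Finset PowerSeries

lemma treeSum_zero (ψ : ℕ → ℝ) : treeSum 0 ψ = 0 := by
  have : parentTrees (univ : Finset (Fin 0)) = ∅ := by
    ext ⟨f, r⟩
    exact r.elim0
  rw [treeSum, this, sum_empty]

lemma treeSum_const_mul (n : ℕ) (c : ℝ) (ψ : ℕ → ℝ) :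
    treeSum n (fun h => c * ψ h) = c * treeSum n ψ := by
  simp only [treeSum, mul_sum]

lemma treeSum_mul_const (n : ℕ) (c : ℝ) (ψ : ℕ → ℝ) :
    treeSum n (fun h => ψ h * c) = treeSum n ψ * c := by
  simp only [treeSum, sum_mul]

lemma treeSum_sum {ι : Type*} (s : Finset ι) (n : ℕ) (ψ : ι → ℕ → ℝ) :
    treeSum n (fun h => ∑ i ∈ s, ψ i h) = ∑ i ∈ s, treeSum n (ψ i) := by
  simp only [treeSum]
  exact sum_comm

/-- The exponential generating function of a sequence. -/
noncomputable def egf (a : ℕ → ℝ) : ℝ⟦X⟧ := PowerSeries.mk fun n => a n / n.factorial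

@[simp] lemma coeff_egf (a : ℕ → ℝ) (n : ℕ) : coeff n (egf a) = a n / n.factorial := by
  simp [egf]

lemma egf_mul (a b : ℕ → ℝ) :
    egf a * egf b = egf fun n => ∑ j ∈ range (n + 1), (n.choose j : ℝ) * (a j * b (n - j)) := by
  ext n
  rw [coeff_mul, Nat.sum_antidiagonal_eq_sum_range_succ_mk, coeff_egf, sum_div]
  refine sum_congr rfl fun j hj => ?_
  rw [Nat.cast_choose ℝ (Nat.lt_succ_iff.1 (mem_range.1 hj))]
  simp only [coeff_egf]
  have := Nat.factorial_ne_zero n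
  field_simp

/-- The derivation `X d/dX`. -/
noncomputable def theta : Derivation ℝ ℝ⟦X⟧ ℝ⟦X⟧ := (X : ℝ⟦X⟧) • derivative ℝ

lemma coeff_theta (f : ℝ⟦X⟧) (n : ℕ) : coeff n (theta f) = n * coeff n f := by
  rw [theta, Derivation.smul_apply, smul_eq_mul]
  cases n with
  | zero => simp
  | succ n => rw [coeff_succ_X_mul, coeff_derivative, mul_comm]; push_cast; rfl

lemma coeff_theta_iterate (f : ℝ⟦X⟧) (a n : ℕ) :
    coeff n (theta^[a] f) = (n : ℝ) ^ a * coeff n f := by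
  induction a with
  | zero => simp
  | succ a ih => rw [Function.iterate_succ_apply', coeff_theta, ih, pow_succ']; ring

/-- The exponential generating function of the sums of the `k`-th powers of the total heights. -/
noncomputable def momentSeries (k : ℕ) : ℝ⟦X⟧ := egf fun n => treeSum n fun h => (h : ℝ) ^ k

/-- The exponential generating function of the sums of the `k`-th powers of total height plus
size. -/
noncomputable def shiftedMomentSeries (k : ℕ) : ℝ⟦X⟧ :=
  egf fun n => treeSum n fun h => ((n : ℝ) + h) ^ k

lemma shiftedMomentSeries_eq (k : ℕ) :
    shiftedMomentSeries k
      = ∑ a ∈ range (k + 1), (k.choose a : ℝ) • theta^[a] (momentSeries (k - a)) := by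
  ext n
  rw [map_sum, shiftedMomentSeries, coeff_egf]
  simp only [add_pow]
  rw [treeSum_sum, sum_div]
  refine sum_congr rfl fun a _ => ?_
  rw [coeff_smul, coeff_theta_iterate, momentSeries, coeff_egf, treeSum_mul_const,
    treeSum_const_mul, smul_eq_mul]
  ring

/-- The terms of `shiftedMomentSeries (m + 1)` other than `momentSeries (m + 1)`. -/
noncomputable def lowerSeries (m : ℕ) : ℝ⟦X⟧ :=
  ∑ a ∈ range (m + 1), ((m + 1).choose (a + 1) : ℝ) • theta^[a + 1] (momentSeries (m - a))

lemma shiftedMomentSeries_succ (m : ℕ) :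
    shiftedMomentSeries (m + 1) = lowerSeries m + momentSeries (m + 1) := by
  rw [shiftedMomentSeries_eq, sum_range_succ', lowerSeries]
  simp

/-- This is `treeSum_mul` for `ψ h = h ^ k`, with `((j + h) + h') ^ k` expanded binomially so that
the two pieces separate into a product of series. -/
lemma momentSeries_succ (k : ℕ) :
    momentSeries (k + 1) = ∑ i ∈ range (k + 1),
      (k.choose i : ℝ) • (shiftedMomentSeries (i + 1) * momentSeries (k - i)) := by
  ext n
  rw [map_sum, momentSeries, coeff_egf]
  simp only [shiftedMomentSeries, momentSeries, egf_mul, coeff_smul, coeff_egf, smul_eq_mul,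
    pow_succ']
  rw [treeSum_mul n fun h => (h : ℝ) ^ k]
  simp only [← mul_div_assoc, mul_sum]
  rw [← sum_div, sum_comm]
  congr 1
  refine sum_congr rfl fun j _ => ?_
  have : ∀ h h' : ℕ, ((j : ℝ) + h) * ((j : ℝ) + h + h') ^ k
      = ∑ i ∈ range (k + 1),
        (((j : ℝ) + h) * ((j : ℝ) + h) ^ i * (k.choose i : ℝ)) * (h' : ℝ) ^ (k - i) := by
    intro h h'
    rw [add_pow, mul_sum]
    exact sum_congr rfl fun i _ => by ring
  push_cast
  simp only [this, treeSum_sum, treeSum_const_mul, treeSum_mul_const, mul_sum]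
  exact sum_congr rfl fun i _ => by ring

/-- The tree function. -/
noncomputable abbrev treeSeries : ℝ⟦X⟧ := momentSeries 0

lemma treeSeries_eq : treeSeries = egf fun n => treeSum n fun _ => 1 := by
  simp [momentSeries]

lemma constantCoeff_treeSeries : constantCoeff treeSeries = 0 := by
  rw [← coeff_zero_eq_constantCoeff_apply, treeSeries_eq, coeff_egf, treeSum_zero, zero_div]

lemma theta_treeSeries : theta treeSeries = treeSeries + theta treeSeries * treeSeries := by
  have h : theta treeSeries = egf fun n => n * treeSum n fun _ => 1 := by
    ext n
    rw [coeff_theta, treeSeries_eq, coeff_egf, coeff_egf, mul_div_assoc]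
  rw [h, treeSeries_eq, egf_mul]
  ext n
  rw [map_add, coeff_egf, coeff_egf, coeff_egf, ← add_div, card_mul_treeSum]
  congr 2
  refine sum_congr rfl fun j _ => ?_
  congr 1
  simp only [treeSum_const_mul]
  have := treeSum_mul_const j (treeSum (n - j) fun _ => 1) fun _ => 1
  simp only [one_mul] at this
  rw [this]
  ring

/-- The series `1 / (1 - T)`, where `T` is the tree function. -/
noncomputable def poleSeries : ℝ⟦X⟧ := (1 - treeSeries)⁻¹

lemma one_sub_treeSeries_mul : (1 - treeSeries) * poleSeries = 1 :=
  PowerSeries.mul_inv_cancel _ (by simp [constantCoeff_treeSeries])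

lemma poleSeries_mul_treeSeries : poleSeries * treeSeries = poleSeries - 1 := by
  linear_combination -one_sub_treeSeries_mul

lemma theta_treeSeries_eq : theta treeSeries = poleSeries - 1 := by
  linear_combination poleSeries * theta_treeSeries - theta treeSeries * one_sub_treeSeries_mul
    + poleSeries_mul_treeSeries

/-- Differentiating `(1 - T) y = 1` gives `θ y = y ^ 2 θ T`, and `θ T = y - 1`. Polynomials in `y`
are therefore stable under `θ`. -/
lemma theta_poleSeries : theta poleSeries = poleSeries ^ 3 - poleSeries ^ 2 := by
  have h := congrArg theta one_sub_treeSeries_mul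
  rw [Derivation.leibniz, map_sub, Derivation.map_one_eq_zero, theta_treeSeries_eq, smul_eq_mul,
    smul_eq_mul] at h
  linear_combination poleSeries * h - theta poleSeries * one_sub_treeSeries_mul

/-- `f` is a polynomial of degree at most `d` in `1 / (1 - T)`, and `c` is the coefficient of
degree `d`. -/
def HasLead (f : ℝ⟦X⟧) (d : ℕ) (c : ℝ) : Prop :=
  ∃ P : Polynomial ℝ, P.natDegree ≤ d ∧ P.coeff d = c ∧ Polynomial.aeval poleSeries P = f

namespace HasLead

variable {f g : ℝ⟦X⟧} {d e : ℕ} {c b : ℝ}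

lemma add (hf : HasLead f d c) (hg : HasLead g d b) : HasLead (f + g) d (c + b) := by
  obtain ⟨P, hP, rfl, rfl⟩ := hf
  obtain ⟨Q, hQ, rfl, rfl⟩ := hg
  exact ⟨P + Q, Polynomial.natDegree_add_le_of_degree_le hP hQ, by simp, by simp⟩

lemma smul (r : ℝ) (hf : HasLead f d c) : HasLead (r • f) d (r * c) := by
  obtain ⟨P, hP, rfl, rfl⟩ := hf
  exact ⟨r • P, (Polynomial.natDegree_smul_le r P).trans hP, by simp, by simp⟩

lemma mul (hf : HasLead f d c) (hg : HasLead g e b) : HasLead (f * g) (d + e) (c * b) := by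
  obtain ⟨P, hP, rfl, rfl⟩ := hf
  obtain ⟨Q, hQ, rfl, rfl⟩ := hg
  exact ⟨P * Q, Polynomial.natDegree_mul_le_of_le hP hQ,
    Polynomial.coeff_mul_add_eq_of_natDegree_le hP hQ, by simp⟩

lemma mono (hf : HasLead f d c) (h : d < e) : HasLead f e 0 := by
  obtain ⟨P, hP, rfl, rfl⟩ := hf
  exact ⟨P, hP.trans h.le, Polynomial.coeff_eq_zero_of_natDegree_lt (hP.trans_lt h), rfl⟩

lemma zero (d : ℕ) : HasLead 0 d 0 := ⟨0, by simp⟩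

lemma sum {ι : Type*} (s : Finset ι) {f : ι → ℝ⟦X⟧} {c : ι → ℝ}
    (h : ∀ i ∈ s, HasLead (f i) d (c i)) : HasLead (∑ i ∈ s, f i) d (∑ i ∈ s, c i) := by
  classical
  induction s using Finset.induction_on with
  | empty => simpa using zero d
  | insert i s hi ih =>
    rw [sum_insert hi, sum_insert hi]
    exact (h i (mem_insert_self _ _)).add (ih fun j hj => h j (mem_insert_of_mem hj))

/-- `θ (P y) = P'(y) (y ^ 3 - y ^ 2)`: differentiation lowers the degree by one and the factor
raises it by three. -/
lemma theta (hf : HasLead f d c) : HasLead (theta f) (d + 2) (d * c) := by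
  obtain ⟨P, hP, rfl, rfl⟩ := hf
  have hcoeff : ∀ m, ((Polynomial.X * P.derivative - P.derivative) * Polynomial.X ^ 2).coeff (m + 2)
      = m * P.coeff m - P.coeff (m + 1) * (m + 1) := by
    intro m
    rw [Polynomial.coeff_mul_X_pow, Polynomial.coeff_sub, Polynomial.coeff_derivative]
    cases m with
    | zero => simp
    | succ m => rw [Polynomial.coeff_X_mul, Polynomial.coeff_derivative]; push_cast; ring
  refine ⟨(Polynomial.X * P.derivative - P.derivative) * Polynomial.X ^ 2, ?_, ?_, ?_⟩
  · rw [Polynomial.natDegree_le_iff_coeff_eq_zero]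
    intro N hN
    obtain ⟨m, rfl⟩ := Nat.exists_eq_add_of_le' (show 2 ≤ N by omega)
    rw [hcoeff, Polynomial.coeff_eq_zero_of_natDegree_lt (by omega),
      Polynomial.coeff_eq_zero_of_natDegree_lt (by omega)]
    simp
  · rw [hcoeff, Polynomial.coeff_eq_zero_of_natDegree_lt (Nat.lt_succ_of_le hP)]
    simp
  · rw [Derivation.map_aeval, theta_poleSeries, smul_eq_mul]
    simp
    ring

lemma theta_iterate (hf : HasLead f d c) (a : ℕ) :
    ∃ b, HasLead (RootedTreeHeights.theta^[a] f) (d + 2 * a) b := by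
  induction a with
  | zero => exact ⟨c, hf⟩
  | succ a ih =>
    obtain ⟨b, hb⟩ := ih
    rw [Function.iterate_succ_apply']
    exact ⟨_, hb.theta⟩

end HasLead

lemma hasLead_poleSeries : HasLead poleSeries 1 1 :=
  ⟨Polynomial.X, by simp, by simp, by simp⟩

lemma hasLead_poleSeries_sub_one : HasLead (poleSeries - 1) 1 1 :=
  ⟨Polynomial.X - 1, by
    simpa using Polynomial.natDegree_X_sub_C_le (1 : ℝ), by simp [Polynomial.coeff_one], by simp⟩

/-- The leading coefficients of the moment series: `leadCoeff m` belongs to the `(m + 1)`-st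
moment. -/
def leadCoeff (m : ℕ) : ℕ :=
  (if m = 0 then 1 else (m + 1) * (3 * m - 1) * leadCoeff (m - 1))
    + ∑ i : Fin m, m.choose i * (leadCoeff i * leadCoeff (m - 1 - i))
  termination_by m
  decreasing_by all_goals omega

/-- Each `θ` raises the degree by two while each lost power of the height lowers it by three, so
only the summand `a = 0` reaches degree `3 m + 1`. For `m = 0` that summand is `θ T = y - 1`. -/
lemma hasLead_lowerSeries (m : ℕ)
    (h : ∀ j < m, HasLead (momentSeries (j + 1)) (3 * j + 2) (leadCoeff j)) :
    HasLead (lowerSeries m) (3 * m + 1)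
      (if m = 0 then 1 else (m + 1) * (3 * m - 1 : ℕ) * leadCoeff (m - 1) : ℝ) := by
  cases m with
  | zero =>
    have : lowerSeries 0 = poleSeries - 1 := by
      simp [lowerSeries, theta_treeSeries_eq]
    simpa [this] using hasLead_poleSeries_sub_one
  | succ m =>
    have htail : HasLead (∑ a ∈ range (m + 1), ((m + 1 + 1).choose (a + 1 + 1) : ℝ) •
        theta^[a + 1 + 1] (momentSeries (m + 1 - (a + 1)))) (3 * (m + 1) + 1) 0 := by
      rw [← sum_const_zero (s := range (m + 1))]
      refine HasLead.sum _ fun a ha => ?_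
      rw [mem_range] at ha
      rw [← mul_zero ((m + 1 + 1).choose (a + 1 + 1) : ℝ)]
      refine HasLead.smul _ ?_
      rcases Nat.lt_or_ge a m with ham | ham
      · obtain ⟨b, hb⟩ := (h (m - 1 - a) (by omega)).theta_iterate (a + 1 + 1)
        rw [show m + 1 - (a + 1) = m - 1 - a + 1 by omega]
        exact hb.mono (by omega)
      · obtain rfl : a = m := by omega
        obtain ⟨b, hb⟩ := hasLead_poleSeries_sub_one.theta_iterate (a + 1)
        rw [Nat.sub_self, Function.iterate_succ_apply, theta_treeSeries_eq]
        exact hb.mono (by omega)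
    rw [lowerSeries, sum_range_succ']
    have hhead := ((h m (by omega)).theta).smul ((m + 1 + 1).choose (0 + 1) : ℝ)
    convert htail.add hhead using 1
    · rfl
    rw [if_neg m.succ_ne_zero, Nat.add_sub_cancel, show 3 * (m + 1) - 1 = 3 * m + 2 by omega]
    simp
    ring

theorem hasLead_momentSeries (m : ℕ) :
    HasLead (momentSeries (m + 1)) (3 * m + 2) (leadCoeff m) := by
  induction m using Nat.strong_induction_on with
  | _ m ih =>
    have hlow := hasLead_lowerSeries m ih
    -- Adding the size to the height changes the series only in degree at most `3 j + 1`, hence not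
    -- its leading term.
    have hshift : ∀ j < m, HasLead (shiftedMomentSeries (j + 1)) (3 * j + 2) (leadCoeff j) := by
      intro j hj
      rw [shiftedMomentSeries_succ, ← zero_add (leadCoeff j : ℝ)]
      exact ((hasLead_lowerSeries j fun i hi => ih i (hi.trans hj)).mono (by omega)).add (ih j hj)
    have hsum : HasLead (∑ i ∈ range m, (m.choose i : ℝ) •
        (shiftedMomentSeries (i + 1) * momentSeries (m - i))) (3 * m + 1)
        (∑ i ∈ range m, (m.choose i : ℝ) * (leadCoeff i * leadCoeff (m - 1 - i))) := by
      refine HasLead.sum _ fun i hi => HasLead.smul _ ?_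
      rw [mem_range] at hi
      have := (hshift i hi).mul (ih (m - 1 - i) (by omega))
      rwa [show m - 1 - i + 1 = m - i by omega,
        show 3 * i + 2 + (3 * (m - 1 - i) + 2) = 3 * m + 1 by omega] at this
    -- The summand `i = m` of the recursion contains the unknown series times `T`. Moving it to the
    -- left leaves a factor `1 - T`, which is cancelled by `y`; the rest uses `y T = y - 1`.
    have heq : momentSeries (m + 1) = (poleSeries - 1) * lowerSeries m
        + poleSeries * ∑ i ∈ range m, (m.choose i : ℝ) •
          (shiftedMomentSeries (i + 1) * momentSeries (m - i)) := by
      have h := momentSeries_succ m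
      rw [sum_range_succ, shiftedMomentSeries_succ m, Nat.choose_self, Nat.sub_self, Nat.cast_one,
        one_smul] at h
      linear_combination poleSeries * h - momentSeries (m + 1) * one_sub_treeSeries_mul
        + lowerSeries m * poleSeries_mul_treeSeries
    rw [heq, leadCoeff]
    convert (hasLead_poleSeries_sub_one.mul hlow).add (hasLead_poleSeries.mul hsum) using 1
    · ring
    · push_cast
      rw [Fin.sum_univ_eq_sum_range
        (fun i => (m.choose i : ℝ) * (leadCoeff i * leadCoeff (m - 1 - i)))]
      simp only [one_mul]

end RootedTreeHeights

namespace RootedTreeHeights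

open Finset Filter Topology

/-! ### Abel's binomial identity -/

section Abel

open Polynomial

lemma eq_of_derivative_eq_of_eval_eq {p q : ℝ[X]} (h : derivative p = derivative q) (x : ℝ)
    (hx : p.eval x = q.eval x) : p = q := by
  have h1 : derivative (p - q) = 0 := by rw [derivative_sub, h, sub_self]
  have h2 := eq_C_of_natDegree_eq_zero (derivative_eq_zero.1 h1)
  have h3 : (p - q).eval x = 0 := by rw [eval_sub, hx, sub_self]
  rw [h2, eval_C] at h3
  rw [h3, C_0] at h2
  exact sub_eq_zero.1 h2

/-- A form of Abel's binomial identity. -/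
theorem sum_choose_mul_X_add_pow (m : ℕ) :
    ∑ k ∈ range (m + 1), ((m + 1).choose (k + 1) * ((k : ℝ) + 1) ^ k) •
        (X + C ((m - k : ℕ) : ℝ)) ^ (m - k)
      = ((m : ℝ) + 1) • (X + C ((m : ℝ) + 1)) ^ m := by
  induction m with
  | zero => simp
  | succ m ih =>
    -- The derivative of each side is `m + 2` times the corresponding side of the previous case,
    -- with `X` shifted by one.
    have hder : derivative (∑ k ∈ range (m + 1 + 1),
          ((m + 1 + 1).choose (k + 1) * ((k : ℝ) + 1) ^ k) •
            (X + C ((m + 1 - k : ℕ) : ℝ)) ^ (m + 1 - k))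
        = derivative ((((m + 1 : ℕ) : ℝ) + 1) • (X + C (((m + 1 : ℕ) : ℝ) + 1)) ^ (m + 1)) := by
      have h := congrArg (fun p : ℝ[X] => ((m : ℝ) + 2) • p.comp (X + C 1)) ih
      simp only [Polynomial.sum_comp, smul_comp, pow_comp, add_comp, X_comp, C_comp, smul_sum,
        smul_smul] at h
      rw [sum_range_succ, derivative_add, derivative_sum, Nat.sub_self, pow_zero,
        derivative_smul (_ : ℝ), derivative_one, smul_zero, add_zero]
      simp only [derivative_smul, derivative_X_add_C_pow]
      have h1 : ∀ k ∈ range (m + 1), ((m + 1 + 1).choose (k + 1) * ((k : ℝ) + 1) ^ k) •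
            (C ((m + 1 - k : ℕ) : ℝ) * (X + C ((m + 1 - k : ℕ) : ℝ)) ^ (m + 1 - k - 1))
          = (((m : ℝ) + 2) * ((m + 1).choose (k + 1) * ((k : ℝ) + 1) ^ k)) •
            (X + C 1 + C ((m - k : ℕ) : ℝ)) ^ (m - k) := by
        intro k hk
        have hk' : k ≤ m := Nat.lt_succ_iff.1 (mem_range.1 hk)
        obtain ⟨l, rfl⟩ := Nat.exists_eq_add_of_le hk'
        rw [show k + l + 1 - k = l + 1 by omega, show k + l - k = l by omega, Nat.add_sub_cancel,
          ← smul_eq_C_mul, smul_smul, add_assoc X, ← C_add]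
        have hc : (((k + l + 1 + 1).choose (k + 1) : ℕ) : ℝ) * ((l : ℝ) + 1)
            = ((k : ℝ) + l + 2) * ((k + l + 1).choose (k + 1) : ℕ) := by
          have := Nat.choose_mul_succ_eq (k + l + 1) (k + 1)
          rw [show k + l + 1 + 1 - (k + 1) = l + 1 by omega] at this
          have h2 : (((k + l + 1).choose (k + 1) * (k + l + 1 + 1) : ℕ) : ℝ)
            = ((k + l + 1 + 1).choose (k + 1) * (l + 1) : ℕ) := congrArg _ this
          push_cast at h2
          linear_combination -h2
        congr 1
        · push_cast
          linear_combination ((k : ℝ) + 1) ^ k * hc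
        · push_cast
          rw [add_comm (1 : ℝ)]
      rw [sum_congr rfl h1, h, Nat.add_sub_cancel, ← smul_eq_C_mul, smul_smul, add_assoc, ← C_add]
      push_cast
      congr 1
      · ring
      · congr 3; ring
    -- At this point the right side vanishes, and the left side becomes the alternating sum
    -- expressing the `(m + 2)`-nd difference of `x ^ (m + 1)` at `0`, which is zero.
    refine eq_of_derivative_eq_of_eval_eq hder (-((m : ℝ) + 2)) ?_
    have hdiff := congrFun (fwdDiff_iter_pow_eq_zero_of_lt (R := ℝ) (Nat.lt_succ_self (m + 1))) 0
    rw [fwdDiff_iter_eq_sum_shift, sum_range_succ'] at hdiff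
    simp only [eval_finsetSum, eval_smul, eval_pow, eval_add, eval_X, eval_C]
    have hr : -((m : ℝ) + 2) + (((m + 1 : ℕ) : ℝ) + 1) = 0 := by push_cast; ring
    rw [hr, zero_pow m.succ_ne_zero, smul_zero]
    simp at hdiff
    rw [← hdiff]
    refine sum_congr rfl fun k hk => ?_
    obtain ⟨l, hl⟩ := Nat.exists_eq_add_of_le (Nat.lt_succ_iff.1 (mem_range.1 hk))
    rw [show m + 1 - k = l by omega, hl]
    have hb : -((m : ℝ) + 2) + l = -1 * ((k : ℝ) + 1) := by
      have : (m : ℝ) + 1 = k + l := by exact_mod_cast hl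
      linear_combination -this
    rw [hb, mul_pow, smul_eq_mul, pow_add]
    ring

end Abel

/-! ### Limits of convolutions -/

section Convolution

/-- Averages with weights that vanish pointwise of a null sequence tend to zero. -/
lemma tendsto_sum_mul_zero {ε : ℕ → ℝ} (hε : Tendsto ε atTop (𝓝 0)) {p : ℕ → ℕ → ℝ}
    (hp : ∀ n j, 0 ≤ p n j) (hp1 : ∀ n, ∑ j ∈ range (n + 1), p n j ≤ 1)
    (hp0 : ∀ j, Tendsto (fun n => p n j) atTop (𝓝 0)) :
    Tendsto (fun n => ∑ j ∈ range (n + 1), p n j * ε j) atTop (𝓝 0) := by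
  rw [Metric.tendsto_atTop]
  intro δ hδ
  obtain ⟨N, hN⟩ := Metric.tendsto_atTop.1 hε (δ / 2) (by positivity)
  have hhead : Tendsto (fun n => ∑ j ∈ range N, p n j * |ε j|) atTop (𝓝 0) := by
    have := tendsto_finsetSum (range N) fun j _ => (hp0 j).mul_const |ε j|
    simpa using this
  obtain ⟨N', hN'⟩ := Metric.tendsto_atTop.1 hhead (δ / 2) (by positivity)
  refine ⟨max N N', fun n hn => ?_⟩
  have h1 := hN' n (le_of_max_le_right hn)
  rw [Real.dist_eq, sub_zero] at h1 ⊢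
  have hle : ∀ j ∈ range (n + 1), |p n j * ε j| ≤
      (if j < N then p n j * |ε j| else 0) + p n j * (δ / 2) := by
    intro j _
    rw [abs_mul, abs_of_nonneg (hp n j)]
    split_ifs with hj
    · have := mul_nonneg (hp n j) (half_pos hδ).le
      linarith
    · have := (hN j (not_lt.1 hj)).le
      rw [Real.dist_eq, sub_zero] at this
      rw [zero_add]
      exact mul_le_mul_of_nonneg_left this (hp n j)
  have h2 : ∑ j ∈ range (n + 1), (if j < N then p n j * |ε j| else 0)
      ≤ ∑ j ∈ range N, p n j * |ε j| := by
    rw [← sum_filter]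
    refine sum_le_sum_of_subset_of_nonneg (fun j hj => ?_) fun j _ _ => mul_nonneg (hp n j)
      (abs_nonneg _)
    exact mem_range.2 (mem_filter.1 hj).2
  calc |∑ j ∈ range (n + 1), p n j * ε j|
      ≤ ∑ j ∈ range (n + 1), |p n j * ε j| := abs_sum_le_sum_abs _ _
    _ ≤ ∑ j ∈ range (n + 1), ((if j < N then p n j * |ε j| else 0) + p n j * (δ / 2)) :=
        sum_le_sum hle
    _ = ∑ j ∈ range (n + 1), (if j < N then p n j * |ε j| else 0)
          + (∑ j ∈ range (n + 1), p n j) * (δ / 2) := by rw [sum_add_distrib, sum_mul]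
    _ ≤ ∑ j ∈ range N, p n j * |ε j| + 1 * (δ / 2) := by
        gcongr
        exact hp1 n
    _ < δ := by linarith [le_abs_self (∑ j ∈ range N, p n j * |ε j|)]

/-- If `β` is a null sequence whose convolution square is constantly one, then the convolution
square of a sequence asymptotic to `c β` tends to `c ^ 2`. -/
lemma tendsto_convolution {β ρ : ℕ → ℝ} {c : ℝ} (hβ : ∀ n, 0 ≤ β n)
    (hβ0 : Tendsto β atTop (𝓝 0)) (hβ1 : ∀ n, ∑ j ∈ range (n + 1), β j * β (n - j) = 1)
    (hρ : Tendsto ρ atTop (𝓝 c)) :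
    Tendsto (fun n => ∑ j ∈ range (n + 1), (ρ j * β j) * (ρ (n - j) * β (n - j))) atTop
      (𝓝 (c ^ 2)) := by
  have hε : Tendsto (fun n => ρ n - c) atTop (𝓝 0) := by simpa using hρ.sub_const c
  obtain ⟨B, hB⟩ : ∃ B, ∀ n, |ρ n| ≤ B := by
    obtain ⟨B, hB⟩ := (Metric.isBounded_range_of_tendsto ρ hρ).exists_norm_le
    exact ⟨B, fun n => hB _ ⟨n, rfl⟩⟩
  have hp0 : ∀ j, Tendsto (fun n => β j * β (n - j)) atTop (𝓝 0) := fun j => by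
    simpa using (hβ0.comp (tendsto_sub_atTop_nat j)).const_mul (β j)
  have hpos : ∀ n j, 0 ≤ β j * β (n - j) := fun n j => mul_nonneg (hβ _) (hβ _)
  have h1 := tendsto_sum_mul_zero hε hpos (fun n => (hβ1 n).le) hp0
  have h2 := tendsto_sum_mul_zero (by simpa using hε.abs) hpos (fun n => (hβ1 n).le) hp0
  -- The decomposition used is `ρ j * ρ (n - j) = (ρ j - c) * ρ (n - j) + c * (ρ (n - j) - c) + c ^
  -- 2`; the weighted sums of the first two terms vanish in the limit.
  have h3 : Tendsto (fun n => ∑ j ∈ range (n + 1),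
      β j * β (n - j) * ((ρ j - c) * ρ (n - j))) atTop (𝓝 0) := by
    refine squeeze_zero_norm (fun n => ?_) (by simpa using h2.const_mul B)
    rw [Real.norm_eq_abs, mul_sum]
    refine (abs_sum_le_sum_abs _ _).trans (sum_le_sum fun j _ => ?_)
    rw [abs_mul, abs_mul (ρ j - c), abs_of_nonneg (hpos n j)]
    calc β j * β (n - j) * (|ρ j - c| * |ρ (n - j)|)
        ≤ β j * β (n - j) * (|ρ j - c| * B) := by
          gcongr
          · exact hpos n j
          · exact hB _
      _ = B * (β j * β (n - j) * |ρ j - c|) := by ring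
  have h4 := (h3.add (h1.const_mul c)).add_const (c ^ 2)
  simp only [mul_zero, add_zero, zero_add] at h4
  refine h4.congr fun n => ?_
  have hflip : ∑ j ∈ range (n + 1), β j * β (n - j) * (ρ j - c)
      = ∑ j ∈ range (n + 1), β j * β (n - j) * (ρ (n - j) - c) := by
    rw [← sum_range_reflect]
    refine sum_congr rfl fun j hj => ?_
    have hj' := mem_range.1 hj
    rw [show n + 1 - 1 - j = n - j by omega, show n - (n - j) = j by omega]
    ring
  rw [hflip, mul_sum, ← sum_add_distrib, ← mul_one (c ^ 2), ← hβ1 n, mul_sum, ← sum_add_distrib]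
  exact sum_congr rfl fun j _ => by ring

-- The generating series `B` satisfies `2 (1 - X) B' = B`. Hence `(1 - X) B ^ 2` has derivative zero
-- and constant term one, so `B ^ 2 = 1 / (1 - X)`.
open PowerSeries in
lemma sum_centralBinom_mul (n : ℕ) :
    ∑ j ∈ range (n + 1), ((j.centralBinom : ℝ) / 4 ^ j) * ((n - j).centralBinom / 4 ^ (n - j))
      = 1 := by
  set B : ℝ⟦X⟧ := PowerSeries.mk fun n => (n.centralBinom : ℝ) / 4 ^ n with hB
  have hode : 2 * ((1 - X) * d⁄dX ℝ B) = B := by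
    ext n
    have hrec : ((n : ℝ) + 1) * ((n + 1).centralBinom : ℕ) = 2 * (2 * n + 1) * n.centralBinom := by
      exact_mod_cast n.succ_mul_centralBinom_succ
    have h2 : (2 : ℝ⟦X⟧) = C (2 : ℝ) := (map_ofNat C 2).symm
    rw [h2, coeff_C_mul, sub_mul, one_mul, map_sub, coeff_derivative]
    cases n with
    | zero =>
      norm_num at hrec
      simp [hB, hrec]
      norm_num
    | succ n =>
      rw [coeff_succ_X_mul, coeff_derivative]
      simp only [hB, coeff_mk]
      push_cast at hrec ⊢
      rw [pow_succ 4 (n + 1)]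
      field_simp
      linear_combination 2 * hrec
  have hsq : (1 - X) * B ^ 2 = 1 := by
    refine derivative.ext ?_ ?_
    · rw [Derivation.leibniz, derivative_pow, map_sub, Derivation.map_one_eq_zero, derivative_X]
      simp only [smul_eq_mul]
      push_cast
      linear_combination B * hode
    · simp [hB]
  have hone : (1 - X) * (PowerSeries.mk 1 : ℝ⟦X⟧) = 1 := by
    rw [mul_comm]; exact mk_one_mul_one_sub_eq_one ℝ
  have hfinal : B * B = PowerSeries.mk 1 := by
    linear_combination PowerSeries.mk 1 * hsq - B ^ 2 * hone
  have := congrArg (coeff n) hfinal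
  rw [coeff_mul, Nat.sum_antidiagonal_eq_sum_range_succ_mk] at this
  simpa [hB] using this

end Convolution

end RootedTreeHeights

/-! ### Cayley's formula and coefficient asymptotics -/

namespace RootedTreeHeights

open Finset Filter Topology

lemma treeSum_one_one : treeSum 1 (fun _ => 1) = 1 := by
  have : parentTrees (univ : Finset (Fin 1)) = {(id, 0)} := by
    ext ⟨f, r⟩
    rw [mem_parentTrees, mem_singleton]
    refine ⟨fun _ => Subsingleton.elim _ _, fun h => ?_⟩
    rw [h]
    exact ⟨mem_univ _, rfl, fun v _ => ⟨0, Subsingleton.elim _ _⟩, fun _ _ => rfl⟩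
  rw [treeSum, this, sum_singleton]

lemma sum_choose_mul_pow_mul_pow (m : ℕ) :
    ∑ k ∈ range (m + 1), ((m + 1).choose (k + 1) : ℝ) * ((k : ℝ) + 1) ^ k *
        ((m - k : ℕ) : ℝ) ^ (m - k) = ((m : ℝ) + 1) ^ (m + 1) := by
  have h := congrArg (Polynomial.eval 0) (sum_choose_mul_X_add_pow m)
  simp only [Polynomial.eval_finsetSum, Polynomial.eval_smul, Polynomial.eval_pow,
    Polynomial.eval_add, Polynomial.eval_X, Polynomial.eval_C, zero_add, smul_eq_mul] at h
  rw [h, pow_succ']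

/-- Cayley's formula for rooted trees. -/
theorem treeSum_succ_one (m : ℕ) : treeSum (m + 1) (fun _ => 1) = ((m : ℝ) + 1) ^ m := by
  induction m using Nat.strong_induction_on with
  | _ m ih =>
    cases m with
    | zero => simp [treeSum_one_one]
    | succ m =>
      have h := card_mul_treeSum (m + 1 + 1) fun _ => 1
      have hlin : ∀ j i, treeSum j (fun _ => treeSum i fun _ => (j : ℝ) * 1)
          = j * treeSum j (fun _ => 1) * treeSum i fun _ => 1 := by
        intro j i
        have := treeSum_mul_const j (treeSum i fun _ => (j : ℝ) * 1) fun _ => 1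
        simp only [one_mul] at this
        rw [this, treeSum_const_mul]
        ring
      simp only [hlin] at h
      rw [← sum_range_reflect, sum_range_succ'] at h
      -- Here `k + 1` is the size of the piece keeping the root. For `k = m + 1` the detached piece
      -- is empty and the true term is zero, whereas Abel's sum, with `0 ^ 0 = 1`, contributes `(m +
      -- 2) ^ (m + 1)`; this is subtracted.
      have hterm : ∀ k ∈ range (m + 1 + 1),
          (((m + 1 + 1).choose (m + 1 + 1 + 1 - 1 - (k + 1)) : ℕ) : ℝ) *
            (((m + 1 + 1 + 1 - 1 - (k + 1) : ℕ) : ℝ) *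
              treeSum (m + 1 + 1 + 1 - 1 - (k + 1)) (fun _ => 1) *
              treeSum (m + 1 + 1 - (m + 1 + 1 + 1 - 1 - (k + 1))) fun _ => 1)
          = ((m + 1 + 1).choose (k + 1) : ℝ) * ((k : ℝ) + 1) ^ k *
              ((m + 1 - k : ℕ) : ℝ) ^ (m + 1 - k) - if k = m + 1 then ((m : ℝ) + 2) ^ (m + 1) else
                0 := by
        intro k hk
        have hk' : k ≤ m + 1 := Nat.lt_succ_iff.1 (mem_range.1 hk)
        obtain ⟨l, hl⟩ := Nat.exists_eq_add_of_le hk'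
        rw [show m + 1 + 1 + 1 - 1 - (k + 1) = l by omega,
          show m + 1 + 1 - l = k + 1 by omega, show m + 1 - k = l by omega,
          Nat.choose_symm_of_eq_add (show m + 1 + 1 = l + (k + 1) by omega)]
        cases l with
        | zero =>
          obtain rfl : k = m + 1 := by omega
          rw [treeSum_zero, if_pos rfl]
          simp
          ring
        | succ l =>
          rw [if_neg (by omega), ih l (by omega), ih k (by omega)]
          push_cast
          ring
      rw [sum_congr rfl hterm, sum_sub_distrib, sum_choose_mul_pow_mul_pow, sum_ite_eq',
        if_pos (self_mem_range_succ _)] at h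
      simp only [Nat.add_sub_cancel, Nat.sub_zero, Nat.sub_self, treeSum_zero, mul_zero,
        add_zero] at h
      push_cast at h ⊢
      have hm : ((m : ℝ) + 1) ≠ 0 := by positivity
      apply mul_left_cancel₀ hm
      rw [show ((m : ℝ) + 1 + 1) = m + 2 by ring] at h ⊢
      linear_combination h

lemma treeSum_one_pos {n : ℕ} (hn : n ≠ 0) : 0 < treeSum n fun _ => 1 := by
  obtain ⟨m, rfl⟩ := Nat.exists_eq_succ_of_ne_zero hn
  rw [treeSum_succ_one]
  positivity

open PowerSeries in
lemma coeff_poleSeries (n : ℕ) : coeff n poleSeries = (n : ℝ) ^ n / n.factorial := by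
  have h : poleSeries = 1 + theta treeSeries := by rw [theta_treeSeries_eq]; ring
  rw [h, map_add, coeff_theta, treeSeries_eq, coeff_egf]
  cases n with
  | zero => simp
  | succ m =>
    rw [treeSum_succ_one, coeff_one, if_neg m.succ_ne_zero, pow_succ']
    push_cast
    ring

open PowerSeries in
lemma coeff_poleSeries_eq {n : ℕ} (hn : n ≠ 0) :
    coeff n poleSeries = n * ((treeSum n fun _ => 1) / n.factorial) := by
  have h : poleSeries = 1 + theta treeSeries := by rw [theta_treeSeries_eq]; ring
  rw [h, map_add, coeff_theta, treeSeries_eq, coeff_egf, coeff_one, if_neg hn, zero_add]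

lemma sqrt_natCast_ne_zero {n : ℕ} (hn : n ≠ 0) : √(n : ℝ) ≠ 0 :=
  (Real.sqrt_pos.2 (Nat.cast_pos.2 (Nat.pos_of_ne_zero hn))).ne'

lemma tendsto_inv_sqrt_natCast : Tendsto (fun n : ℕ => (√(n : ℝ))⁻¹) atTop (𝓝 0) :=
  tendsto_inv_atTop_zero.comp (Real.tendsto_sqrt_atTop.comp tendsto_natCast_atTop_atTop)

lemma tendsto_poisson_sqrt :
    Tendsto (fun n : ℕ => (n : ℝ) ^ n / n.factorial / Real.exp n * √n) atTop
      (𝓝 (1 / √(2 * Real.pi))) := by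
  have h := (Stirling.tendsto_stirlingSeq_sqrt_pi.const_mul √2).inv₀
    (by positivity)
  rw [← Real.sqrt_mul (by norm_num), ← one_div] at h
  refine h.congr' ?_
  filter_upwards [eventually_ne_atTop 0] with n hn
  have h1 := sqrt_natCast_ne_zero hn
  have h2 : (n : ℝ) ≠ 0 := Nat.cast_ne_zero.2 hn
  have h3 : √(2 : ℝ) ^ 2 = 2 := Real.sq_sqrt (by norm_num)
  have h4 : √(n : ℝ) ^ 2 = n := Real.sq_sqrt (Nat.cast_nonneg n)
  have h5 : Real.exp n = Real.exp 1 ^ n := by rw [← Real.exp_nat_mul, mul_one]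
  rw [Stirling.stirlingSeq, Real.sqrt_mul (by norm_num), h5, div_pow]
  field_simp

lemma tendsto_centralBinom_sqrt :
    Tendsto (fun n : ℕ => (n.centralBinom : ℝ) / 4 ^ n * √n) atTop (𝓝 (1 / √Real.pi)) := by
  have hs := Stirling.tendsto_stirlingSeq_sqrt_pi
  have h2 : Tendsto (fun n : ℕ => 2 * n) atTop atTop :=
    tendsto_id.const_mul_atTop' (by norm_num)
  have h := (hs.comp h2).div (hs.pow 2) (by positivity)
  have hlim : √Real.pi / √Real.pi ^ 2 = 1 / √Real.pi := by
    have : √Real.pi ≠ 0 := by positivity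
    field_simp
  rw [hlim] at h
  refine h.congr' ?_
  filter_upwards [eventually_ne_atTop 0] with n hn
  have h1 := sqrt_natCast_ne_zero hn
  have h2 : (n : ℝ) ≠ 0 := Nat.cast_ne_zero.2 hn
  have h3 : √(2 : ℝ) ^ 2 = 2 := Real.sq_sqrt (by norm_num)
  have h4 : √(n : ℝ) ^ 2 = n := Real.sq_sqrt (Nat.cast_nonneg n)
  have h5 : (n.centralBinom : ℝ) = (2 * n).factorial / (n.factorial * n.factorial) := by
    rw [Nat.centralBinom_eq_two_mul_choose, Nat.cast_choose ℝ (by omega),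
      show 2 * n - n = n by omega]
  have h6 : √(2 * (2 * (n : ℝ))) = 2 * √n := by
    rw [← mul_assoc, Real.sqrt_mul (by norm_num), show (2 : ℝ) * 2 = 2 ^ 2 by norm_num,
      Real.sqrt_sq (by norm_num)]
  simp only [Pi.div_apply, Function.comp_apply, Stirling.stirlingSeq]
  rw [h5]
  push_cast
  rw [h6, Real.sqrt_mul (by norm_num), mul_div_assoc 2, mul_pow 2 _ (2 * n), pow_mul 2 2 n,
    show (2 : ℝ) ^ 2 = 4 by norm_num, mul_comm 2 n, pow_mul]
  have h7 : ((n : ℝ) / Real.exp 1) ≠ 0 := by positivity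
  field_simp
  rw [h3]

/-- The limit of the coefficient of `X ^ n` in `(1 / (1 - T)) ^ m`, divided by
`exp n * n ^ (m / 2 - 1)`. -/
noncomputable def poleLimit : ℕ → ℝ
  | 0 => 0
  | 1 => 1 / √(2 * Real.pi)
  | 2 => 1 / 2
  | m + 3 => poleLimit (m + 1) / ((m : ℝ) + 1)

-- The coefficients of `y`, divided by `exp n`, are asymptotic to `1 / √2` times `β n`. The
-- convolution square of `β` is constantly one, so that of the rescaled coefficients tends to `(1 /
-- √2) ^ 2`.
open PowerSeries in
lemma tendsto_coeff_poleSeries_sq :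
    Tendsto (fun n : ℕ => coeff n (poleSeries ^ 2) / Real.exp n) atTop (𝓝 (1 / 2)) := by
  set β : ℕ → ℝ := fun n => (n.centralBinom : ℝ) / 4 ^ n with hβ
  have hpos : ∀ n, 0 < β n := fun n =>
    div_pos (Nat.cast_pos.2 n.centralBinom_pos) (by positivity)
  have hβ0 : Tendsto β atTop (𝓝 0) := by
    have h := tendsto_centralBinom_sqrt.mul tendsto_inv_sqrt_natCast
    rw [mul_zero] at h
    refine h.congr' ?_
    filter_upwards [eventually_ne_atTop 0] with n hn
    rw [mul_assoc, mul_inv_cancel₀ (sqrt_natCast_ne_zero hn), mul_one]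
  have hρ : Tendsto (fun n : ℕ => (n : ℝ) ^ n / n.factorial / Real.exp n / β n) atTop
      (𝓝 ((1 / √(2 * Real.pi)) / (1 / √Real.pi))) := by
    refine (tendsto_poisson_sqrt.div tendsto_centralBinom_sqrt (by positivity)).congr' ?_
    filter_upwards [eventually_ne_atTop 0] with n hn
    exact mul_div_mul_right _ _ (sqrt_natCast_ne_zero hn)
  have h := tendsto_convolution (fun n => (hpos n).le) hβ0 sum_centralBinom_mul hρ
  have hc : ((1 / √(2 * Real.pi)) / (1 / √Real.pi)) ^ 2 = 1 / 2 := by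
    have := Real.pi_pos
    rw [div_pow, div_pow, div_pow, Real.sq_sqrt (by positivity), Real.sq_sqrt (by positivity)]
    field_simp
  rw [hc] at h
  refine h.congr fun n => ?_
  rw [sq, coeff_mul, Nat.sum_antidiagonal_eq_sum_range_succ_mk, sum_div]
  refine sum_congr rfl fun j hj => ?_
  have hexp : Real.exp n = Real.exp j * Real.exp ((n - j : ℕ) : ℝ) := by
    rw [← Real.exp_add, ← Nat.cast_add, Nat.add_sub_cancel' (Nat.lt_succ_iff.1 (mem_range.1 hj))]
  rw [div_mul_cancel₀ _ (hpos j).ne', div_mul_cancel₀ _ (hpos (n - j)).ne', coeff_poleSeries,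
    coeff_poleSeries, hexp, div_mul_div_comm]

-- Compare coefficients in `θ (y ^ (m + 1)) = (m + 1) (y ^ (m + 3) - y ^ (m + 2))`. This raises
-- exponents by two, so the powers one and two suffice as starting values for the asymptotics.
open PowerSeries in
lemma coeff_poleSeries_pow_add_three (m n : ℕ) :
    coeff n (poleSeries ^ (m + 3))
      = coeff n (poleSeries ^ (m + 2)) + n / ((m : ℝ) + 1) * coeff n (poleSeries ^ (m + 1)) := by
  have h := congrArg (coeff n) (theta.leibniz_pow poleSeries (m + 1))
  rw [coeff_theta, theta_poleSeries, Nat.add_sub_cancel, smul_eq_mul,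
    show poleSeries ^ m * (poleSeries ^ 3 - poleSeries ^ 2)
      = poleSeries ^ (m + 3) - poleSeries ^ (m + 2) by ring, map_nsmul, map_sub, nsmul_eq_mul] at h
  push_cast at h
  have hm : ((m : ℝ) + 1) ≠ 0 := by positivity
  field_simp
  linear_combination -h

open PowerSeries in
theorem tendsto_coeff_poleSeries_pow (m : ℕ) :
    Tendsto (fun n : ℕ => coeff n (poleSeries ^ m) * n / (Real.exp n * √n ^ m)) atTop
      (𝓝 (poleLimit m)) := by
  induction m using Nat.strong_induction_on with
  | _ m ih =>
    match m, ih with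
    | 0, _ =>
      refine tendsto_const_nhds.congr' ?_
      filter_upwards [eventually_ne_atTop 0] with n hn
      simp [coeff_one, hn, poleLimit]
    | 1, _ =>
      refine tendsto_poisson_sqrt.congr' ?_
      filter_upwards [eventually_ne_atTop 0] with n hn
      have h1 := sqrt_natCast_ne_zero hn
      have h4 : √(n : ℝ) ^ 2 = n := Real.sq_sqrt (Nat.cast_nonneg n)
      rw [pow_one, pow_one, coeff_poleSeries]
      field_simp
      rw [h4]
    | 2, _ =>
      refine tendsto_coeff_poleSeries_sq.congr' ?_
      filter_upwards [eventually_ne_atTop 0] with n hn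
      rw [Real.sq_sqrt (Nat.cast_nonneg n), mul_div_mul_right _ _ (Nat.cast_ne_zero.2 hn)]
    | m + 3, ih =>
      have h := ((ih (m + 2) (by omega)).mul tendsto_inv_sqrt_natCast).add
        ((ih (m + 1) (by omega)).div_const ((m : ℝ) + 1))
      rw [mul_zero, zero_add] at h
      refine h.congr' ?_
      filter_upwards [eventually_ne_atTop 0] with n hn
      have h1 := sqrt_natCast_ne_zero hn
      have h4 : √(n : ℝ) ^ 2 = n := Real.sq_sqrt (Nat.cast_nonneg n)
      have hm : ((m : ℝ) + 1) ≠ 0 := by positivity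
      have e2 : √(n : ℝ) ^ (m + 2) = √(n : ℝ) ^ (m + 1) * √n := pow_succ _ _
      have e3 : √(n : ℝ) ^ (m + 3) = √(n : ℝ) ^ (m + 1) * n :=
        (pow_add _ (m + 1) 2).trans (by rw [h4])
      rw [coeff_poleSeries_pow_add_three, e2, e3]
      have h5 : (n : ℝ) ≠ 0 := Nat.cast_ne_zero.2 hn
      have h6 : √(n : ℝ) ^ (m + 1) ≠ 0 := pow_ne_zero _ h1
      have h7 := Real.exp_ne_zero n
      generalize √(n : ℝ) ^ (m + 1) = q at *
      field_simp
      rw [h4]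

-- Each further power of `y` contributes a factor of order `√n` to the coefficients, so all but the
-- top power are negligible.
open PowerSeries in
lemma HasLead.tendsto {f : ℝ⟦X⟧} {d : ℕ} {c : ℝ} (hf : HasLead f d c) :
    Tendsto (fun n : ℕ => coeff n f * n / (Real.exp n * √n ^ d)) atTop (𝓝 (c * poleLimit d)) := by
  obtain ⟨P, hP, rfl, rfl⟩ := hf
  have hlow : ∀ m ∈ range d, Tendsto
      (fun n : ℕ => P.coeff m * coeff n (poleSeries ^ m) * n / (Real.exp n * √n ^ d)) atTop
      (𝓝 0) := by
    intro m hm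
    obtain ⟨l, rfl⟩ := Nat.exists_eq_add_of_lt (mem_range.1 hm)
    have h := ((tendsto_coeff_poleSeries_pow m).const_mul (P.coeff m)).mul
      (tendsto_inv_sqrt_natCast.pow (l + 1))
    rw [zero_pow l.succ_ne_zero, mul_zero] at h
    refine h.congr fun n => ?_
    rw [add_assoc, pow_add _ m, inv_pow, ← mul_div_assoc, ← div_eq_mul_inv, div_div]
    ring_nf
  have h := (tendsto_finsetSum _ hlow).add
    ((tendsto_coeff_poleSeries_pow d).const_mul (P.coeff d))
  rw [sum_const_zero, zero_add] at h
  refine h.congr fun n => ?_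
  rw [Polynomial.aeval_eq_sum_range' (Nat.lt_succ_of_le hP), map_sum, sum_range_succ, add_mul,
    add_div, sum_mul, sum_div]
  simp only [coeff_smul, smul_eq_mul, mul_assoc, mul_div_assoc]

end RootedTreeHeights

/-! ### Limits of moments -/

namespace RootedTreeHeights

open Finset Filter Topology

/-- The limit of the `k`-th moment of the total height, divided by `n ^ (3 k / 2)`. -/
noncomputable def momentLimit : ℕ → ℝ
  | 0 => 1
  | m + 1 => leadCoeff m * poleLimit (3 * m + 2) * √(2 * Real.pi)

/-- For positive `n` the number of trees over `n!` is the coefficient of `y` divided by `n`, so the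
moment is a quotient of coefficients of two polynomials in `y`; the exponentials cancel. -/
theorem tendsto_moment (k : ℕ) :
    Tendsto (fun n => expectation n (fun T => (totalHeight T : ℝ) ^ k) / √(n : ℝ) ^ (3 * k)) atTop
      (𝓝 (momentLimit k)) := by
  cases k with
  | zero =>
    refine tendsto_const_nhds.congr' ?_
    filter_upwards [eventually_ne_atTop 0] with n hn
    have := expectation_totalHeight n fun h => (h : ℝ) ^ 0
    simp only [pow_zero] at this
    simp [this, (treeSum_one_pos hn).ne', momentLimit]
  | succ m =>
    have h1 := hasLead_poleSeries.tendsto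
    have hne : (1 : ℝ) * poleLimit 1 ≠ 0 := by
      rw [one_mul, poleLimit]
      positivity
    have h := (hasLead_momentSeries m).tendsto.div h1 hne
    have hlim : leadCoeff m * poleLimit (3 * m + 2) / (1 * poleLimit 1) = momentLimit (m + 1) := by
      rw [one_mul, momentLimit, poleLimit, div_div_eq_mul_div, div_one]
    rw [hlim] at h
    refine h.congr' ?_
    filter_upwards [eventually_ne_atTop 0] with n hn
    have hs := sqrt_natCast_ne_zero hn
    have h2 : √(n : ℝ) ^ 2 = n := Real.sq_sqrt (Nat.cast_nonneg n)
    have hn' : (n : ℝ) ≠ 0 := Nat.cast_ne_zero.2 hn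
    have h3 : √(n : ℝ) ^ (3 * (m + 1)) = √(n : ℝ) ^ (3 * m + 2) * √n := pow_succ _ _
    have h4 : √(n : ℝ) ^ (3 * m + 2) ≠ 0 := pow_ne_zero _ hs
    have h5 := (treeSum_one_pos hn).ne'
    have h6 : (n.factorial : ℝ) ≠ 0 := Nat.cast_ne_zero.2 n.factorial_ne_zero
    have h7 := Real.exp_ne_zero n
    rw [expectation_totalHeight n fun h => (h : ℝ) ^ (m + 1), Pi.div_apply,
      coeff_poleSeries_eq hn, momentSeries, coeff_egf, h3]
    generalize √(n : ℝ) ^ (3 * m + 2) = q at *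
    field_simp
    rw [h2]

lemma expectation_sum_mul {ι : Type*} (n : ℕ) (s : Finset ι)
    (f : ι → SimpleGraph (Fin n) × Fin n → ℝ) (c : ι → ℝ) :
    expectation n (fun T => ∑ i ∈ s, f i T * c i) = ∑ i ∈ s, expectation n (f i) * c i := by
  simp only [expectation]
  rw [sum_comm, sum_div]
  exact sum_congr rfl fun i _ => by rw [← sum_mul, div_mul_eq_mul_div]

/-- The limit of the `k`-th central moment of the total height, divided by `n ^ (3 k / 2)`. -/
noncomputable def centralLimit (k : ℕ) : ℝ :=
  ∑ i ∈ range (k + 1), momentLimit i * ((-momentLimit 1) ^ (k - i) * k.choose i)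

/-- All terms in the binomial expansion about the mean are scaled by the same `n ^ (3 k / 2)`, so
the limit is taken termwise. -/
theorem tendsto_centralMoment (k : ℕ) :
    Tendsto (fun n => centralMoment n k / √(n : ℝ) ^ (3 * k)) atTop (𝓝 (centralLimit k)) := by
  have h : Tendsto (fun n : ℕ => ∑ i ∈ range (k + 1),
      expectation n (fun T => (totalHeight T : ℝ) ^ i) / √(n : ℝ) ^ (3 * i) *
        ((-(expectation n (fun T => (totalHeight T : ℝ) ^ 1) / √(n : ℝ) ^ (3 * 1))) ^ (k - i) *
          k.choose i)) atTop (𝓝 (centralLimit k)) :=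
    tendsto_finsetSum _ fun i _ =>
      (tendsto_moment i).mul (((tendsto_moment 1).neg.pow (k - i)).mul_const _)
  refine h.congr fun n => ?_
  have hc : centralMoment n k = ∑ i ∈ range (k + 1),
      expectation n (fun T => (totalHeight T : ℝ) ^ i) *
        ((-meanHeight n) ^ (k - i) * k.choose i) := by
    rw [← expectation_sum_mul, centralMoment]
    congr 1
    funext T
    rw [sub_eq_add_neg, add_pow]
    exact sum_congr rfl fun i _ => by ring
  rw [hc, sum_div]
  refine sum_congr rfl fun i hi => ?_
  have hk : √(n : ℝ) ^ (3 * k) = √(n : ℝ) ^ (3 * i) * √(n : ℝ) ^ (3 * (k - i)) := by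
    rw [← pow_add, ← mul_add, Nat.add_sub_cancel' (Nat.lt_succ_iff.1 (mem_range.1 hi))]
  rw [hk, mul_one, ← neg_div, div_pow, ← pow_mul, meanHeight]
  simp only [pow_one]
  rw [div_mul_eq_mul_div, div_mul_eq_mul_div, mul_div_assoc', div_div,
    mul_comm (√(n : ℝ) ^ (3 * i))]

theorem tendsto_standardizedMoment (k : ℕ) (h2 : 0 < centralLimit 2) :
    Tendsto (fun n => standardizedMoment n k) atTop
      (𝓝 (centralLimit k / √(centralLimit 2) ^ k)) := by
  have h := (tendsto_centralMoment k).div ((tendsto_centralMoment 2).sqrt.pow k) (by positivity)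
  refine h.congr' ?_
  filter_upwards [eventually_ne_atTop 0] with n hn
  have hs := sqrt_natCast_ne_zero hn
  have h6 : √(√(n : ℝ) ^ (3 * 2)) = √(n : ℝ) ^ 3 := by
    rw [pow_mul, Real.sqrt_sq (by positivity)]
  rw [Pi.div_apply, Real.sqrt_div' _ (by positivity), h6, div_pow, ← pow_mul, standardizedMoment,
    div_div_div_cancel_right₀ (pow_ne_zero _ hs)]

end RootedTreeHeights

/-! ### Explicit values of the limits -/

namespace RootedTreeHeights

open Finset

section Values

lemma leadCoeff_zero : leadCoeff 0 = 1 := by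
  rw [leadCoeff]
  simp

lemma leadCoeff_one : leadCoeff 1 = 5 := by
  rw [leadCoeff]
  simp [leadCoeff_zero]

lemma leadCoeff_two : leadCoeff 2 = 90 := by
  rw [leadCoeff]
  simp [Fin.sum_univ_succ, leadCoeff_zero, leadCoeff_one, Nat.choose]

lemma leadCoeff_three : leadCoeff 3 = 3315 := by
  rw [leadCoeff]
  simp [Fin.sum_univ_succ, leadCoeff_zero, leadCoeff_one, leadCoeff_two, Nat.choose]

lemma leadCoeff_four : leadCoeff 4 = 203400 := by
  rw [leadCoeff]
  simp [Fin.sum_univ_succ, leadCoeff_zero, leadCoeff_one, leadCoeff_two, leadCoeff_three,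
    Nat.choose]

lemma leadCoeff_five : leadCoeff 5 = 18635625 := by
  rw [leadCoeff]
  simp [Fin.sum_univ_succ, leadCoeff_zero, leadCoeff_one, leadCoeff_two, leadCoeff_three,
    leadCoeff_four, Nat.choose]

lemma leadCoeff_six : leadCoeff 6 = 2379888000 := by
  rw [leadCoeff]
  simp [Fin.sum_univ_succ, leadCoeff_zero, leadCoeff_one, leadCoeff_two, leadCoeff_three,
    leadCoeff_four, leadCoeff_five, Nat.choose]

lemma leadCoeff_seven : leadCoeff 7 = 403839930375 := by
  rw [leadCoeff]
  simp [Fin.sum_univ_succ, leadCoeff_zero, leadCoeff_one, leadCoeff_two, leadCoeff_three,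
    leadCoeff_four, leadCoeff_five, leadCoeff_six, Nat.choose]

lemma leadCoeff_eight : leadCoeff 8 = 87883648272000 := by
  rw [leadCoeff]
  simp [Fin.sum_univ_succ, leadCoeff_zero, leadCoeff_one, leadCoeff_two, leadCoeff_three,
    leadCoeff_four, leadCoeff_five, leadCoeff_six, leadCoeff_seven, Nat.choose]

lemma momentLimit_zero : momentLimit 0 = 1 := rfl

lemma momentLimit_one : momentLimit 1 = 1/2 * √(2 * Real.pi) := by
  rw [momentLimit, leadCoeff_zero]
  norm_num [poleLimit]

lemma momentLimit_two : momentLimit 2 = 5/3 := by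
  have h : √(2 * Real.pi) ≠ 0 := by positivity
  rw [momentLimit, leadCoeff_one]
  norm_num [poleLimit]
  field_simp

lemma momentLimit_three : momentLimit 3 = 15/16 * √(2 * Real.pi) := by
  rw [momentLimit, leadCoeff_two]
  norm_num [poleLimit]

lemma momentLimit_four : momentLimit 4 = 221/63 := by
  have h : √(2 * Real.pi) ≠ 0 := by positivity
  rw [momentLimit, leadCoeff_three]
  norm_num [poleLimit]
  field_simp
  norm_num

lemma momentLimit_five : momentLimit 5 = 565/256 * √(2 * Real.pi) := by
  rw [momentLimit, leadCoeff_four]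
  norm_num [poleLimit]

lemma momentLimit_six : momentLimit 6 = 82825/9009 := by
  have h : √(2 * Real.pi) ≠ 0 := by positivity
  rw [momentLimit, leadCoeff_five]
  norm_num [poleLimit]
  field_simp
  norm_num

lemma momentLimit_seven : momentLimit 7 = 19675/3072 * √(2 * Real.pi) := by
  rw [momentLimit, leadCoeff_six]
  norm_num [poleLimit]

lemma momentLimit_eight : momentLimit 8 = 256406305/8729721 := by
  have h : √(2 * Real.pi) ≠ 0 := by positivity
  rw [momentLimit, leadCoeff_seven]
  norm_num [poleLimit]
  field_simp
  norm_num

lemma momentLimit_nine : momentLimit 9 = 16145585/720896 * √(2 * Real.pi) := by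
  rw [momentLimit, leadCoeff_eight]
  norm_num [poleLimit]

lemma centralLimit_two : centralLimit 2 =
    -(1/2) * Real.pi + 5/3 := by
  -- Writing `π` through `s = √(2 π)` makes the claim a polynomial identity in `s`; the same device
  -- serves the higher moments.
  have h : Real.pi = √(2 * Real.pi) ^ 2 / 2 := by
    rw [Real.sq_sqrt (by positivity)]
    ring
  simp only [centralLimit, sum_range_succ, range_zero, sum_empty, momentLimit_zero,
    momentLimit_one, momentLimit_two]
  generalize √(2 * Real.pi) = s at *
  rw [h]
  norm_num [Nat.choose]
  ring

lemma centralLimit_three : centralLimit 3 =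
    (1/2 * Real.pi - 25/16) * √(2 * Real.pi) := by
  have h : Real.pi = √(2 * Real.pi) ^ 2 / 2 := by
    rw [Real.sq_sqrt (by positivity)]
    ring
  simp only [centralLimit, sum_range_succ, range_zero, sum_empty, momentLimit_zero,
    momentLimit_one, momentLimit_two, momentLimit_three]
  generalize √(2 * Real.pi) = s at *
  rw [h]
  norm_num [Nat.choose]
  ring

lemma centralLimit_four : centralLimit 4 =
    -(3/4) * Real.pi ^ 2 + 5/4 * Real.pi + 221/63 := by
  have h : Real.pi = √(2 * Real.pi) ^ 2 / 2 := by
    rw [Real.sq_sqrt (by positivity)]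
    ring
  simp only [centralLimit, sum_range_succ, range_zero, sum_empty, momentLimit_zero,
    momentLimit_one, momentLimit_two, momentLimit_three, momentLimit_four]
  generalize √(2 * Real.pi) = s at *
  rw [h]
  norm_num [Nat.choose]
  ring

lemma centralLimit_five : centralLimit 5 =
    (1/2 * Real.pi ^ 2 + 25/48 * Real.pi - 105845/16128) * √(2 * Real.pi) := by
  have h : Real.pi = √(2 * Real.pi) ^ 2 / 2 := by
    rw [Real.sq_sqrt (by positivity)]
    ring
  simp only [centralLimit, sum_range_succ, range_zero, sum_empty, momentLimit_zero,
    momentLimit_one, momentLimit_two, momentLimit_three, momentLimit_four, momentLimit_five]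
  generalize √(2 * Real.pi) = s at *
  rw [h]
  norm_num [Nat.choose]
  ring

lemma centralLimit_six : centralLimit 6 =
    -(5/8) * Real.pi ^ 3 - 25/8 * Real.pi ^ 2 + 35125/2688 * Real.pi + 82825/9009 := by
  have h : Real.pi = √(2 * Real.pi) ^ 2 / 2 := by
    rw [Real.sq_sqrt (by positivity)]
    ring
  simp only [centralLimit, sum_range_succ, range_zero, sum_empty, momentLimit_zero,
    momentLimit_one, momentLimit_two, momentLimit_three, momentLimit_four, momentLimit_five,
    momentLimit_six]
  generalize √(2 * Real.pi) = s at *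
  rw [h]
  norm_num [Nat.choose]
  ring

lemma centralLimit_seven : centralLimit 7 =
    (3/8 * Real.pi ^ 3 + 245/64 * Real.pi ^ 2 - 34655/4608 * Real.pi - 33965825/1317888) * √(2 *
      Real.pi) := by
  have h : Real.pi = √(2 * Real.pi) ^ 2 / 2 := by
    rw [Real.sq_sqrt (by positivity)]
    ring
  simp only [centralLimit, sum_range_succ, range_zero, sum_empty, momentLimit_zero,
    momentLimit_one, momentLimit_two, momentLimit_three, momentLimit_four, momentLimit_five,
    momentLimit_six, momentLimit_seven]
  generalize √(2 * Real.pi) = s at *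
  rw [h]
  norm_num [Nat.choose]
  ring

lemma centralLimit_eight : centralLimit 8 =
    -(7/16) * Real.pi ^ 4 - 175/24 * Real.pi ^ 3 - 235/576 * Real.pi ^ 2 + 12762625/164736 *
      Real.pi + 256406305/8729721 := by
  have h : Real.pi = √(2 * Real.pi) ^ 2 / 2 := by
    rw [Real.sq_sqrt (by positivity)]
    ring
  simp only [centralLimit, sum_range_succ, range_zero, sum_empty, momentLimit_zero,
    momentLimit_one, momentLimit_two, momentLimit_three, momentLimit_four, momentLimit_five,
    momentLimit_six, momentLimit_seven, momentLimit_eight]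
  generalize √(2 * Real.pi) = s at *
  rw [h]
  norm_num [Nat.choose]
  ring

lemma centralLimit_nine : centralLimit 9 =
    (1/4 * Real.pi ^ 4 + 195/32 * Real.pi ^ 3 + 7307/512 * Real.pi ^ 2 - 17084675/219648 * Real.pi
      - 6978220262525/63567888384) * √(2 * Real.pi) := by
  have h : Real.pi = √(2 * Real.pi) ^ 2 / 2 := by
    rw [Real.sq_sqrt (by positivity)]
    ring
  simp only [centralLimit, sum_range_succ, range_zero, sum_empty, momentLimit_zero,
    momentLimit_one, momentLimit_two, momentLimit_three, momentLimit_four, momentLimit_five,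
    momentLimit_six, momentLimit_seven, momentLimit_eight, momentLimit_nine]
  generalize √(2 * Real.pi) = s at *
  rw [h]
  norm_num [Nat.choose]
  ring

end Values

end RootedTreeHeights

/-! ### Closed forms and decimal bounds -/

namespace RootedTreeHeights

section Closed

open Real

lemma ten_sub_three_mul_pi_pos : 0 < 10 - 3 * π := by linarith [pi_lt_d20]

lemma centralLimit_two_eq : centralLimit 2 = (10 - 3 * π) / 6 := by
  rw [centralLimit_two]
  ring

lemma centralLimit_two_pos : 0 < centralLimit 2 := by
  rw [centralLimit_two_eq]
  exact div_pos ten_sub_three_mul_pi_pos (by norm_num)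

lemma div_sqrt_pow_even (x : ℝ) (j : ℕ) :
    x / √(centralLimit 2) ^ (2 * j) = x / ((10 - 3 * π) / 6) ^ j := by
  rw [pow_mul, sq_sqrt centralLimit_two_pos.le, centralLimit_two_eq]

lemma div_sqrt_pow_odd (x : ℝ) (j : ℕ) :
    x * √(2 * π) / √(centralLimit 2) ^ (2 * j + 1)
      = 2 * x * √3 * √(π / (10 - 3 * π)) / ((10 - 3 * π) / 6) ^ j := by
  have hD := ten_sub_three_mul_pi_pos
  -- This extracts one standard deviation from `√(2 π)`, cancelling the odd one in the denominator.
  have h : √(2 * π) = 2 * √3 * √(π / (10 - 3 * π)) * √(centralLimit 2) := by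
    rw [centralLimit_two_eq, mul_assoc, mul_assoc, ← sqrt_mul (by positivity),
      ← sqrt_mul (by norm_num), show (3 : ℝ) * (π / (10 - 3 * π) * ((10 - 3 * π) / 6)) = π / 2 by
        field_simp; norm_num,
      show 2 * π = 2 ^ 2 * (π / 2) by ring, sqrt_mul (by norm_num), sqrt_sq (by norm_num)]
  have h2 : √(centralLimit 2) ≠ 0 := (sqrt_pos.2 centralLimit_two_pos).ne'
  rw [pow_succ, pow_mul, sq_sqrt centralLimit_two_pos.le, h, ← mul_assoc x,
    mul_div_mul_right _ _ h2,
    centralLimit_two_eq]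
  ring

/-- After squaring and clearing the denominator, both bounds are linear inequalities in `π`. -/
lemma sqrt_three_mul_sqrt_bounds :
    4.0477884329370232 < √3 * √(π / (10 - 3 * π)) ∧
      √3 * √(π / (10 - 3 * π)) < 4.0477884329370233 := by
  have hD := ten_sub_three_mul_pi_pos
  rw [← sqrt_mul (by norm_num), ← mul_div_assoc, lt_sqrt (by norm_num), sqrt_lt' (by norm_num),
    lt_div_iff₀ hD, div_lt_iff₀ hD]
  constructor <;> nlinarith [pi_gt_d20, pi_lt_d20]

lemma pi_pow_bounds {n : ℕ} (hn : n ≠ 0) :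
    (3.14159265358979323846 : ℝ) ^ n < π ^ n ∧ π ^ n < (3.14159265358979323847 : ℝ) ^ n :=
  ⟨pow_lt_pow_left₀ pi_gt_d20 (by norm_num) hn, pow_lt_pow_left₀ pi_lt_d20 pi_pos.le hn⟩

lemma mul_sqrt_div_bounds {p d l u : ℝ} (hd : 0 < d) (hp : 0 < p)
    (hl : l * d < p * 4.0477884329370232) (hu : p * 4.0477884329370233 < u * d) :
    l < p * √3 * √(π / (10 - 3 * π)) / d ∧ p * √3 * √(π / (10 - 3 * π)) / d < u := by
  obtain ⟨h1, h2⟩ := sqrt_three_mul_sqrt_bounds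
  rw [mul_assoc p, lt_div_iff₀ hd, div_lt_iff₀ hd]
  exact ⟨hl.trans (mul_lt_mul_of_pos_left h1 hp), (mul_lt_mul_of_pos_left h2 hp).trans hu⟩

end Closed

end RootedTreeHeights

open RootedTreeHeights in
theorem mainTheorem5 :
    ∃ α : ℕ → ℝ,
      (∀ k : ℕ, 3 ≤ k → k ≤ 9 →
        Filter.Tendsto (fun n : ℕ => RootedTreeHeights.standardizedMoment n k)
          Filter.atTop (nhds (α k))) ∧
      (α 3 = (6 * Real.pi - 75 / 4) * √3 * √(Real.pi / (10 - 3 * Real.pi))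
          / (10 - 3 * Real.pi) ∧
        0.7005665293 < α 3 ∧ α 3 < 0.7005665294) ∧
      (α 4 = (-189 * Real.pi ^ 2 + 315 * Real.pi + 884) / (7 * (10 - 3 * Real.pi) ^ 2) ∧
        3.560394897 < α 4 ∧ α 4 < 3.560394898) ∧
      (α 5 = (36 * Real.pi ^ 2 + 75 / 2 * Real.pi - 105845 / 224)
          * √3 * √(Real.pi / (10 - 3 * Real.pi)) / (10 - 3 * Real.pi) ^ 2 ∧
        7.256375358 < α 5 ∧ α 5 < 7.256375359) ∧
      (α 6 = 15 / 16016 * ((-144144 * Real.pi ^ 3 - 720720 * Real.pi ^ 2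
          + 3013725 * Real.pi + 2120320) / (10 - 3 * Real.pi) ^ 3) ∧
        27.68552569 < α 6 ∧ α 6 < 27.68552570) ∧
      (α 7 = (162 * Real.pi ^ 3 + 6615 / 4 * Real.pi ^ 2 - 103965 / 32 * Real.pi
          - 101897475 / 9152)
          * √3 * √(Real.pi / (10 - 3 * Real.pi)) / (10 - 3 * Real.pi) ^ 3 ∧
        90.01718290 < α 7 ∧ α 7 < 90.01718291) ∧
      (α 8 = 3 / 2586584 * ((-488864376 * Real.pi ^ 4 - 8147739600 * Real.pi ^ 3
          - 455885430 * Real.pi ^ 2 + 86568885375 * Real.pi + 32820007040)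
          / (10 - 3 * Real.pi) ^ 4) ∧
        358.8090415 < α 8 ∧ α 8 < 358.8090416) ∧
      (α 9 = (648 * Real.pi ^ 4 + 15795 * Real.pi ^ 3 + 591867 / 16 * Real.pi ^ 2
          - 461286225 / 2288 * Real.pi - 188411947088175 / 662165504)
          * √3 * √(Real.pi / (10 - 3 * Real.pi)) / (10 - 3 * Real.pi) ^ 4 ∧
        1460.701134 < α 9 ∧ α 9 < 1460.701135) := by
  refine ⟨fun k => centralLimit k / √(centralLimit 2) ^ k, fun k _ _ =>
    tendsto_standardizedMoment k centralLimit_two_pos, ?_⟩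
  have hD := ten_sub_three_mul_pi_pos
  -- With `π`, …, `π ^ 4` bounded separately, the cleared decimal inequalities are linear in these
  -- powers.
  have h1 := pi_pow_bounds one_ne_zero
  have h2 := pi_pow_bounds two_ne_zero
  have h3 := pi_pow_bounds three_ne_zero
  have h4 := pi_pow_bounds four_ne_zero
  rw [pow_one, pow_one, pow_one] at h1
  norm_num only at h1 h2 h3 h4
  obtain ⟨l1, u1⟩ := h1
  obtain ⟨l2, u2⟩ := h2
  obtain ⟨l3, u3⟩ := h3
  obtain ⟨l4, u4⟩ := h4
  have e3 : centralLimit 3 / √(centralLimit 2) ^ 3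
      = (6 * Real.pi - 75 / 4) * √3 * √(Real.pi / (10 - 3 * Real.pi)) / (10 - 3 * Real.pi) := by
    rw [centralLimit_three]
    refine (div_sqrt_pow_odd _ 1).trans ?_
    field_simp
    ring
  have b3 : 0.7005665293 < centralLimit 3 / √(centralLimit 2) ^ 3
      ∧ centralLimit 3 / √(centralLimit 2) ^ 3 < 0.7005665294 := by
    rw [e3]
    refine mul_sqrt_div_bounds (by positivity) ?_ ?_ ?_ <;> linarith
  have e4 : centralLimit 4 / √(centralLimit 2) ^ 4
      = (-189 * Real.pi ^ 2 + 315 * Real.pi + 884) / (7 * (10 - 3 * Real.pi) ^ 2) := by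
    rw [centralLimit_four]
    refine (div_sqrt_pow_even _ 2).trans ?_
    field_simp
    ring
  have b4 : 3.560394897 < centralLimit 4 / √(centralLimit 2) ^ 4
      ∧ centralLimit 4 / √(centralLimit 2) ^ 4 < 3.560394898 := by
    rw [e4, lt_div_iff₀ (by positivity), div_lt_iff₀ (by positivity)]
    constructor <;> linarith
  have e5 : centralLimit 5 / √(centralLimit 2) ^ 5
      = (36 * Real.pi ^ 2 + 75 / 2 * Real.pi - 105845 / 224) * √3 * √(Real.pi / (10 - 3 * Real.pi))
        / (10 - 3 * Real.pi) ^ 2 := by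
    rw [centralLimit_five]
    refine (div_sqrt_pow_odd _ 2).trans ?_
    field_simp
    ring
  have b5 : 7.256375358 < centralLimit 5 / √(centralLimit 2) ^ 5
      ∧ centralLimit 5 / √(centralLimit 2) ^ 5 < 7.256375359 := by
    rw [e5]
    refine mul_sqrt_div_bounds (by positivity) ?_ ?_ ?_ <;> linarith
  have e6 : centralLimit 6 / √(centralLimit 2) ^ 6
      = 15 / 16016 * ((-144144 * Real.pi ^ 3 - 720720 * Real.pi ^ 2 + 3013725 * Real.pi + 2120320)
        / (10 - 3 * Real.pi) ^ 3) := by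
    rw [centralLimit_six]
    refine (div_sqrt_pow_even _ 3).trans ?_
    field_simp
    ring
  have b6 : 27.68552569 < centralLimit 6 / √(centralLimit 2) ^ 6
      ∧ centralLimit 6 / √(centralLimit 2) ^ 6 < 27.68552570 := by
    rw [e6, ← mul_div_assoc, lt_div_iff₀ (by positivity), div_lt_iff₀ (by positivity)]
    constructor <;> linarith
  have e7 : centralLimit 7 / √(centralLimit 2) ^ 7
      = (162 * Real.pi ^ 3 + 6615 / 4 * Real.pi ^ 2 - 103965 / 32 * Real.pi - 101897475 / 9152) *
        √3 * √(Real.pi / (10 - 3 * Real.pi)) / (10 - 3 * Real.pi) ^ 3 := by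
    rw [centralLimit_seven]
    refine (div_sqrt_pow_odd _ 3).trans ?_
    field_simp
    ring
  have b7 : 90.01718290 < centralLimit 7 / √(centralLimit 2) ^ 7
      ∧ centralLimit 7 / √(centralLimit 2) ^ 7 < 90.01718291 := by
    rw [e7]
    refine mul_sqrt_div_bounds (by positivity) ?_ ?_ ?_ <;> linarith
  have e8 : centralLimit 8 / √(centralLimit 2) ^ 8
      = 3 / 2586584 * ((-488864376 * Real.pi ^ 4 - 8147739600 * Real.pi ^ 3 - 455885430 * Real.pi ^
        2 + 86568885375 * Real.pi + 32820007040) / (10 - 3 * Real.pi) ^ 4) := by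
    rw [centralLimit_eight]
    refine (div_sqrt_pow_even _ 4).trans ?_
    field_simp
    ring
  have b8 : 358.8090415 < centralLimit 8 / √(centralLimit 2) ^ 8
      ∧ centralLimit 8 / √(centralLimit 2) ^ 8 < 358.8090416 := by
    rw [e8, ← mul_div_assoc, lt_div_iff₀ (by positivity), div_lt_iff₀ (by positivity)]
    constructor <;> linarith
  have e9 : centralLimit 9 / √(centralLimit 2) ^ 9
      = (648 * Real.pi ^ 4 + 15795 * Real.pi ^ 3 + 591867 / 16 * Real.pi ^ 2 - 461286225 / 2288 *
        Real.pi - 188411947088175 / 662165504) * √3 * √(Real.pi / (10 - 3 * Real.pi)) / (10 - 3 *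
        Real.pi) ^ 4 := by
    rw [centralLimit_nine]
    refine (div_sqrt_pow_odd _ 4).trans ?_
    field_simp
    ring
  have b9 : 1460.701134 < centralLimit 9 / √(centralLimit 2) ^ 9
      ∧ centralLimit 9 / √(centralLimit 2) ^ 9 < 1460.701135 := by
    rw [e9]
    refine mul_sqrt_div_bounds (by positivity) ?_ ?_ ?_ <;> linarith
  exact ⟨⟨e3, b3.1, b3.2⟩, ⟨e4, b4.1, b4.2⟩, ⟨e5, b5.1, b5.2⟩, ⟨e6, b6.1, b6.2⟩, ⟨e7, b7.1, b7.2⟩,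
    ⟨e8, b8.1, b8.2⟩, ⟨e9, b9.1, b9.2⟩⟩
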